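/- Let $\kappa>0$ and let $\{X_n\}_{n\ge 0}$ be independent, identically distributed real random variables with mean $0$ and variance $\kappa$ on a probability space $(\Omega,\mathcal F,P)$. Put $X_n'=X_n/\sqrt{\kappa}$. For $x\in\mathbb R\setminus\{0\}$ let $\{Y_m\}_{m\ge 0}$ be the Markov chain defined by $Y_0=x$ and \[ Y_m=\sqrt{(Y_{m-1}-X_m')^2+\frac4\kappa},\qquad m\ge 1 \] (nonnegative square root). Call the chain transient if for every starting point $x\neq 0$ one has $Y_m\to\infty$ almost surely, and recurrent if there is a finite $r$ such that for every starting point $x\ne 0$, almost surely $|Y_m|\le r$ for infinitely many $m$. Then: 1. if $\kappa<4$, the chain is transient; 2. if $\kappa>4$, the chain is recurrent; 3. if $\kappa=4$ and the moment generating function of $X_1'$ has a positive radius of convergence, i.e. $\mathbb E[e^{tX_1'}]<\infty$ for all real $t$ in some neighbourhood of $0$, the chain is recurrent. -/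

import Mathlib

/-- The discrete Bessel-type chain driven by the real sequence `ξ` and started at `x`:
`Y 0 = x` and `Y m = √((Y (m - 1) - ξ m) ^ 2 + 4 / κ)` for `m ≥ 1`. -/
noncomputable def besselChain (κ : ℝ) (ξ : ℕ → ℝ) (x : ℝ) : ℕ → ℝ
  | 0 => x
  | m + 1 => Real.sqrt ((besselChain κ ξ x m - ξ (m + 1)) ^ 2 + 4 / κ)

/-- `Y x m` is the position at time `m` of the real-valued chain started at `x`, where the
starting points are the nonzero reals. The chain is transient if, from every starting point,
it almost surely tends to infinity. -/
def IsTransientChain {Ω : Type*} [MeasurableSpace Ω] (P : MeasureTheory.Measure Ω)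
    (Y : ℝ → ℕ → Ω → ℝ) : Prop :=
  ∀ x : ℝ, x ≠ 0 → ∀ᵐ ω ∂P, Filter.Tendsto (fun m => |Y x m ω|) Filter.atTop Filter.atTop

/-- The chain is recurrent if there is one bounded set which, from every starting point,
is almost surely visited infinitely often. -/
def IsRecurrentChain {Ω : Type*} [MeasurableSpace Ω] (P : MeasureTheory.Measure Ω)
    (Y : ℝ → ℕ → Ω → ℝ) : Prop :=
  ∃ r : ℝ, ∀ x : ℝ, x ≠ 0 → ∀ᵐ ω ∂P, ∃ᶠ m in Filter.atTop, |Y x m ω| ≤ r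

/-- The moment generating function `t ↦ E[exp (t Z)]` of `Z` has a positive radius of
convergence: it is finite in a neighbourhood of `0`. -/
def HasPosMgfRadius {Ω : Type*} [MeasurableSpace Ω] (P : MeasureTheory.Measure Ω)
    (Z : Ω → ℝ) : Prop :=
  ∃ ρ : ℝ, 0 < ρ ∧ ∀ t : ℝ, |t| < ρ →
    MeasureTheory.Integrable (fun ω => Real.exp (t * Z ω)) P

/-!
Write `c = 4 / κ`, so that the squared chain jumps from `y ^ 2` to `(y - e) ^ 2 + c` with `e` of
mean `0` and variance `1`. Jumps are negative with positive probability, so long runs of negative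
jumps make the chain unbounded, and a Lyapunov function `φ` of the squared position, whose value
does not increase on average outside a bounded set, decides between the regimes by supermartingale
convergence: the chain is recurrent when `φ → ∞` and transient when `φ` is positive and decreases
to `0`.

Taylor expansion gives a drift of about `(c - 1) / y ^ 2` for `log (y ^ 2)`, so the logarithm works
for `c < 1`. At `c = 1` this vanishes, and the concave function `√log` gains the smaller amount
`1 / (2 (log (y ^ 2)) ^ (3 / 2) y ^ 2)`, which beats the Taylor error as soon as a moment of order
greater than `2` is finite. For `c > 1` the natural candidates are small negative powers, but with
only two moments the jumps of size comparable to `y` are too frequent for any single power; an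
average of `(b / (b + y ^ 2)) ^ ε` over scales `b`, distributed according to the tail of the jump
law, has enough negative drift to absorb them.
-/

open MeasureTheory ProbabilityTheory Filter Topology

/-- `ξ` is a sequence of independent random variables on `(Ω, P)` with common law `ν`. -/
structure IsIIDSeq {Ω E : Type*} [MeasurableSpace Ω] [MeasurableSpace E] (ξ : ℕ → Ω → E)
    (ν : Measure E) (P : Measure Ω) : Prop where
  measurable : ∀ n, Measurable (ξ n)
  iIndepFun : iIndepFun ξ P
  map_eq : ∀ n, P.map (ξ n) = ν

section Probability

variable {Ω : Type*} {m mΩ : MeasurableSpace Ω} {P : Measure Ω}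

theorem setIntegral_comp_prodMk_of_indep {S E : Type*} [MeasurableSpace S] [MeasurableSpace E]
    [IsFiniteMeasure P] (hm : m ≤ mΩ) {U : Ω → S} {ξ : Ω → E}
    (hU : Measurable[m] U) (hξ : Measurable ξ)
    (hind : Indep (MeasurableSpace.comap ξ inferInstance) m P) {s : Set Ω}
    (hs : MeasurableSet[m] s) {T : S × E → ℝ} (hT : Measurable T)
    (hTi : IntegrableOn (fun ω => T (U ω, ξ ω)) s P) :
    IntegrableOn (fun ω => ∫ e, T (U ω, e) ∂(P.map ξ)) s P ∧
      ∫ ω in s, T (U ω, ξ ω) ∂P = ∫ ω in s, ∫ e, T (U ω, e) ∂(P.map ξ) ∂P := by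
  have hU' : Measurable U := hU.mono hm le_rfl
  have hprod : (P.restrict s).map (fun ω => (U ω, ξ ω)) =
      ((P.restrict s).map U).prod (P.map ξ) := by
    refine (Measure.prod_eq fun A B hA hB => ?_).symm
    rw [Measure.map_apply (hU'.prodMk hξ) (hA.prod hB), Measure.map_apply hU' hA,
      Measure.map_apply hξ hB, Measure.restrict_apply (hU' hA),
      Measure.restrict_apply ((hU'.prodMk hξ) (hA.prod hB)), mul_comm,
      ← (Indep_iff _ _ _).1 hind _ _ ⟨B, hB, rfl⟩ ((hU hA).inter hs), Set.mk_preimage_prod,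
      Set.inter_comm (U ⁻¹' A), Set.inter_assoc]
  have hTi' : Integrable T (((P.restrict s).map U).prod (P.map ξ)) := by
    rw [← hprod]
    exact (integrable_map_measure hT.aestronglyMeasurable (hU'.prodMk hξ).aemeasurable).2 hTi
  have hTint := hTi'.integral_prod_left
  refine ⟨(integrable_map_measure hTint.aestronglyMeasurable hU'.aemeasurable).1 hTint, ?_⟩
  calc ∫ ω in s, T (U ω, ξ ω) ∂P
      = ∫ p, T p ∂(((P.restrict s).map U).prod (P.map ξ)) := by
        rw [← hprod, integral_map (hU'.prodMk hξ).aemeasurable hT.aestronglyMeasurable]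
    _ = ∫ u, ∫ e, T (u, e) ∂(P.map ξ) ∂((P.restrict s).map U) := integral_prod _ hTi'
    _ = ∫ ω in s, ∫ e, T (U ω, e) ∂(P.map ξ) ∂P :=
        integral_map hU'.aemeasurable hTint.aestronglyMeasurable

theorem ae_exists_tendsto_of_supermartingale_of_nonneg [IsFiniteMeasure P]
    {G : Filtration ℕ mΩ} {W : ℕ → Ω → ℝ} (hW : Supermartingale W G P) (h0 : ∀ n ω, 0 ≤ W n ω) :
    ∀ᵐ ω ∂P, ∃ l, Tendsto (fun n => W n ω) atTop (𝓝 l) := by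
  have hbdd : ∀ n, eLpNorm ((-W) n) 1 P ≤ (Real.toNNReal (∫ ω, W 0 ω ∂P) : NNReal) := fun n => by
    rw [Pi.neg_apply, eLpNorm_neg, eLpNorm_one_eq_lintegral_enorm,
      ← ofReal_integral_norm_eq_lintegral_enorm (hW.integrable n)]
    refine ENNReal.ofReal_le_ofReal ?_
    simpa only [Real.norm_eq_abs, abs_of_nonneg (h0 n _), setIntegral_univ] using
      hW.setIntegral_le (Nat.zero_le n) MeasurableSet.univ
  filter_upwards [hW.neg.exists_ae_tendsto_of_bdd hbdd] with ω ⟨l, hl⟩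
  exact ⟨-l, by simpa only [Pi.neg_apply, neg_neg] using hl.neg⟩

-- The process is killed at its first visit to `B`, which turns it into a supermartingale.
theorem ae_exists_mem_or_exists_tendsto [IsFiniteMeasure P] {G : Filtration ℕ mΩ}
    {V : ℕ → Ω → ℝ} (hV : StronglyAdapted G V) (hint : ∀ n, Integrable (V n) P)
    (h0 : ∀ n ω, 0 ≤ V n ω) {B : ℕ → Set Ω} (hB : ∀ n, MeasurableSet[G n] (B n))
    (hstep : ∀ n s, MeasurableSet[G n] s → Disjoint s (B n) →
      ∫ ω in s, V (n + 1) ω ∂P ≤ ∫ ω in s, V n ω ∂P) :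
    ∀ᵐ ω ∂P, (∃ n, ω ∈ B n) ∨ ∃ l, Tendsto (fun n => V n ω) atTop (𝓝 l) := by
  let A : ℕ → Set Ω := fun n => ⋂ k ≤ n, (B k)ᶜ
  have hA : ∀ n, MeasurableSet[G n] (A n) := fun n =>
    MeasurableSet.iInter fun k => MeasurableSet.iInter fun hk => (G.mono hk _ (hB k)).compl
  have hA' : ∀ n, MeasurableSet (A n) := fun n => G.le n _ (hA n)
  have hAanti : ∀ n, A (n + 1) ⊆ A n := fun n =>
    Set.biInter_subset_biInter_left fun k hk => Nat.le_succ_of_le hk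
  have hAB : ∀ n, Disjoint (A n) (B n) := fun n =>
    Set.disjoint_left.2 fun ω hω => Set.mem_iInter₂.1 hω n le_rfl
  have hkilled : Supermartingale (fun n => (A n).indicator (V n)) G P := by
    refine supermartingale_of_setIntegral_succ_le (fun n => (hV n).indicator (hA n))
      (fun n => (hint n).indicator (hA' n)) fun n s hs => ?_
    calc ∫ ω in s, (A (n + 1)).indicator (V (n + 1)) ω ∂P
        ≤ ∫ ω in s, (A n).indicator (V (n + 1)) ω ∂P :=
          integral_mono ((hint _).indicator (hA' _)).integrableOn
            ((hint _).indicator (hA' _)).integrableOn fun ω =>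
              Set.indicator_le_indicator_of_subset (hAanti n) (h0 (n + 1)) ω
      _ = ∫ ω in s ∩ A n, V (n + 1) ω ∂P := setIntegral_indicator (hA' n)
      _ ≤ ∫ ω in s ∩ A n, V n ω ∂P :=
          hstep n _ (hs.inter (hA n)) ((hAB n).mono_left Set.inter_subset_right)
      _ = ∫ ω in s, (A n).indicator (V n) ω ∂P := (setIntegral_indicator (hA' n)).symm
  filter_upwards [ae_exists_tendsto_of_supermartingale_of_nonneg hkilled fun n =>
    Set.indicator_nonneg fun ω _ => h0 n ω] with ω ⟨l, hl⟩
  refine or_iff_not_imp_left.2 fun hω => ⟨l, hl.congr fun n => Set.indicator_of_mem ?_ _⟩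
  exact Set.mem_iInter₂.2 fun k _ hk => hω ⟨k, hk⟩

theorem ae_frequently_mem_or_exists_tendsto [IsFiniteMeasure P] {G : Filtration ℕ mΩ}
    {V : ℕ → Ω → ℝ} (hV : StronglyAdapted G V) (hint : ∀ n, Integrable (V n) P)
    (h0 : ∀ n ω, 0 ≤ V n ω) {B : ℕ → Set Ω} (hB : ∀ n, MeasurableSet[G n] (B n))
    (hstep : ∀ n s, MeasurableSet[G n] s → Disjoint s (B n) →
      ∫ ω in s, V (n + 1) ω ∂P ≤ ∫ ω in s, V n ω ∂P) :
    ∀ᵐ ω ∂P, (∃ᶠ n in atTop, ω ∈ B n) ∨ ∃ l, Tendsto (fun n => V n ω) atTop (𝓝 l) := by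
  have hshift : ∀ N, ∀ᵐ ω ∂P, (∃ n, ω ∈ B (n + N)) ∨
      ∃ l, Tendsto (fun n => V (n + N) ω) atTop (𝓝 l) := fun N =>
    ae_exists_mem_or_exists_tendsto
      (G := ⟨fun n => G (n + N), fun i j h => G.mono (by omega), fun n => G.le _⟩)
      (V := fun n => V (n + N)) (B := fun n => B (n + N)) (fun n => hV _) (fun n => hint _)
      (fun n => h0 _) (fun n => hB _) fun n s hs hsB => by
        simpa only [Nat.add_right_comm n 1 N] using hstep (n + N) s hs hsB
  filter_upwards [ae_all_iff.2 hshift] with ω hω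
  by_cases h : ∃ N, ∃ l, Tendsto (fun n => V (n + N) ω) atTop (𝓝 l)
  · obtain ⟨N, l, hl⟩ := h
    exact .inr ⟨l, (tendsto_add_atTop_iff_nat N).1 hl⟩
  · refine .inl (frequently_atTop.2 fun N => ?_)
    obtain ⟨n, hn⟩ := (hω N).resolve_right fun hN => h ⟨N, hN⟩
    exact ⟨n + N, Nat.le_add_left N n, hn⟩

theorem iIndepSet_biInter_preimage {ι β : Type*} [MeasurableSpace β] {ξ : ι → Ω → β}
    (hξ : ∀ i, Measurable (ξ i)) (hind : iIndepFun ξ P) {S : Set β} (hS : MeasurableSet S)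
    {γ : Type*} {I : γ → Finset ι} (hI : Pairwise (Function.onFun Disjoint I)) :
    iIndepSet (fun j => ⋂ i ∈ I j, ξ i ⁻¹' S) P := by
  classical
  have hmeas : ∀ s : Finset ι, P (⋂ i ∈ s, ξ i ⁻¹' S) = ∏ i ∈ s, P (ξ i ⁻¹' S) := fun s =>
    hind.measure_inter_preimage_eq_mul s (sets := fun _ => S) fun _ _ => hS
  rw [iIndepSet_iff_meas_biInter fun j => Finset.measurableSet_biInter _ fun i _ => hξ i hS]
  intro s
  simp only [hmeas]
  rw [← Finset.set_biInter_biUnion, hmeas, Finset.prod_biUnion fun a _ b _ hab => hI hab]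

theorem IsIIDSeq.isProbabilityMeasure [IsProbabilityMeasure P] {β : Type*} [MeasurableSpace β]
    {ξ : ℕ → Ω → β} {ν : Measure β} (hξ : IsIIDSeq ξ ν P) : IsProbabilityMeasure ν :=
  hξ.map_eq 0 ▸ Measure.isProbabilityMeasure_map (hξ.measurable 0).aemeasurable

theorem ae_frequently_forall_mem_Ioc [IsProbabilityMeasure P] {β : Type*} [MeasurableSpace β]
    {ξ : ℕ → Ω → β} {ν : Measure β} (hξ : IsIIDSeq ξ ν P) {S : Set β} (hS : MeasurableSet S)
    (hpos : ν S ≠ 0) (N : ℕ) :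
    ∀ᵐ ω ∂P, ∃ᶠ j in atTop, ∀ i ∈ Finset.Ioc (j * N) ((j + 1) * N), ξ i ω ∈ S := by
  let B : ℕ → Set Ω := fun j => ⋂ i ∈ Finset.Ioc (j * N) ((j + 1) * N), ξ i ⁻¹' S
  have hB : ∀ j, MeasurableSet (B j) := fun j =>
    Finset.measurableSet_biInter _ fun i _ => hξ.measurable i hS
  have hdisj : Pairwise (Function.onFun Disjoint fun j => Finset.Ioc (j * N) ((j + 1) * N)) := by
    intro a b hab
    rw [Function.onFun, ← Finset.disjoint_coe, Finset.coe_Ioc, Finset.coe_Ioc]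
    exact Monotone.pairwise_disjoint_on_Ioc_succ
      (fun i j hij => Nat.mul_le_mul_right N hij) hab
  have hindB : iIndepSet B P := iIndepSet_biInter_preimage hξ.measurable hξ.iIndepFun hS hdisj
  have hPB : ∀ j, P (B j) = ν S ^ N := fun j => by
    have hS' : ∀ i, P (ξ i ⁻¹' S) = ν S := fun i => by
      rw [← hξ.map_eq i, Measure.map_apply (hξ.measurable i) hS]
    rw [hξ.iIndepFun.measure_inter_preimage_eq_mul _ (sets := fun _ => S) fun _ _ => hS]
    simp only [hS', Finset.prod_const, Nat.card_Ioc]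
    congr 1
    rw [add_mul, one_mul, Nat.add_sub_cancel_left]
  have hsum : ∑' j, P (B j) = ⊤ := by
    simp only [hPB]
    exact ENNReal.tsum_const_eq_top_of_ne_zero (pow_ne_zero N hpos)
  have hlim : ∀ᵐ ω ∂P, ω ∈ limsup B atTop :=
    (prob_compl_eq_zero_iff (MeasurableSet.measurableSet_limsup hB)).2
      (measure_limsup_eq_one hB hindB hsum)
  filter_upwards [hlim] with ω hω
  exact (mem_limsup_iff_frequently_mem.1 hω).mono fun j hj => Set.mem_iInter₂.1 hj

theorem integral_min_const_le [IsProbabilityMeasure P] {f : Ω → ℝ} (hf : Integrable f P) (a : ℝ) :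
    ∫ e, min (f e) a ∂P ≤ min (∫ e, f e ∂P) a := by
  have hmin : Integrable (fun e => min (f e) a) P := hf.inf (integrable_const a)
  refine le_min (integral_mono hmin hf fun e => min_le_left _ _) ?_
  simpa using integral_mono hmin (integrable_const a) fun e => min_le_right (f e) a

theorem exists_measure_Iio_neg_ne_zero {ν : Measure ℝ} (hint : Integrable id ν)
    (hmean : ∫ e, e ∂ν = 0) (hν : ∫ e, e ^ 2 ∂ν ≠ 0) :
    ∃ u : ℝ, 0 < u ∧ ν (Set.Iio (-u)) ≠ 0 := by
  by_contra! h
  have hnull : ν (Set.Iio 0) = 0 := by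
    have hU : Set.Iio (0 : ℝ) ⊆ ⋃ n : ℕ, Set.Iio (-(1 / ((n : ℝ) + 1))) := fun e he => by
      obtain ⟨n, hn⟩ := exists_nat_one_div_lt (neg_pos.2 (Set.mem_Iio.1 he))
      exact Set.mem_iUnion.2 ⟨n, lt_neg_of_lt_neg hn⟩
    exact measure_mono_null hU (measure_iUnion_null fun n => h _ (by positivity))
  have hnonneg : 0 ≤ᵐ[ν] id := by
    filter_upwards [measure_eq_zero_iff_ae_notMem.1 hnull] with e he
    exact not_lt.1 he
  have hzero : id =ᵐ[ν] 0 := (integral_eq_zero_iff_of_nonneg_ae hnonneg hint).1 hmean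
  refine hν (integral_eq_zero_of_ae ?_)
  filter_upwards [hzero] with e he
  rw [Pi.zero_apply, show e = 0 from he, zero_pow two_ne_zero]

end Probability

section Chain

theorem tendsto_atTop_of_tendsto_antitoneOn_sq {ψ : ℝ → ℝ} (hpos : ∀ z, 0 ≤ z → 0 < ψ z)
    (hanti : AntitoneOn ψ (Set.Ici 0)) {u : ℕ → ℝ} (hu : ∀ᶠ n in atTop, 0 ≤ u n)
    (h : Tendsto (fun n => ψ (u n ^ 2)) atTop (𝓝 0)) : Tendsto u atTop atTop := by
  refine tendsto_atTop.2 fun r => ?_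
  filter_upwards [hu, h.eventually_lt_const (hpos (r ^ 2) (sq_nonneg r))] with n hn hlt
  by_contra! hr
  exact hlt.not_ge (hanti (sq_nonneg (u n)) (sq_nonneg r) (pow_le_pow_left₀ hn hr.le 2))

theorem besselChain_sq {κ : ℝ} (hκ : 0 < κ) (ξ : ℕ → ℝ) (x : ℝ) (n : ℕ) :
    besselChain κ ξ x (n + 1) ^ 2 = (besselChain κ ξ x n - ξ (n + 1)) ^ 2 + 4 / κ := by
  rw [besselChain, Real.sq_sqrt (by positivity)]

theorem besselChain_succ_nonneg (κ : ℝ) (ξ : ℕ → ℝ) (x : ℝ) (n : ℕ) :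
    0 ≤ besselChain κ ξ x (n + 1) :=
  Real.sqrt_nonneg _

theorem eventually_besselChain_nonneg (κ : ℝ) (ξ : ℕ → ℝ) (x : ℝ) :
    ∀ᶠ n in atTop, 0 ≤ besselChain κ ξ x n :=
  (eventually_ge_atTop 1).mono fun n hn => by
    obtain ⟨n, rfl⟩ := Nat.exists_eq_add_of_le' hn
    exact besselChain_succ_nonneg κ ξ x n

theorem four_div_le_besselChain_sq {κ : ℝ} (hκ : 0 < κ) (ξ : ℕ → ℝ) (x : ℝ) (n : ℕ) :
    4 / κ ≤ besselChain κ ξ x (n + 1) ^ 2 := by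
  rw [besselChain_sq hκ]
  exact le_add_of_nonneg_left (sq_nonneg _)

theorem sub_le_besselChain_succ {κ : ℝ} (hκ : 0 < κ) (ξ : ℕ → ℝ) (x : ℝ) (n : ℕ) :
    besselChain κ ξ x n - ξ (n + 1) ≤ besselChain κ ξ x (n + 1) := by
  refine (abs_le_of_sq_le_sq' ?_ (besselChain_succ_nonneg κ ξ x n)).2
  rw [besselChain_sq hκ]
  exact le_add_of_nonneg_right (by positivity)

theorem natCast_mul_le_besselChain {κ : ℝ} (hκ : 0 < κ) {ξ : ℕ → ℝ} {x u : ℝ} {k N : ℕ}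
    (hk : 0 < k) (h : ∀ i ∈ Finset.Ioc k (k + N), ξ i < -u) :
    N * u ≤ besselChain κ ξ x (k + N) := by
  induction N with
  | zero =>
    obtain ⟨k, rfl⟩ := Nat.exists_eq_succ_of_ne_zero hk.ne'
    simpa using besselChain_succ_nonneg κ ξ x k
  | succ N ih =>
    have hprev := ih fun i hi => h i (Finset.Ioc_subset_Ioc_right (by omega) hi)
    have hjump := h (k + N + 1) (Finset.mem_Ioc.2 (by omega))
    have hstep := sub_le_besselChain_succ hκ ξ x (k + N)
    rw [← add_assoc]
    push_cast
    linarith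

variable {Ω : Type*} [mΩ : MeasurableSpace Ω] {P : Measure Ω} {ξ : ℕ → Ω → ℝ} {κ : ℝ}

theorem measurable_besselChain_natural (hξ : ∀ n, StronglyMeasurable (ξ n)) (κ x : ℝ) (n : ℕ) :
    Measurable[Filtration.natural ξ hξ n] fun ω => besselChain κ (fun i => ξ i ω) x n := by
  induction n with
  | zero => exact measurable_const
  | succ n ih =>
    have hchain : Measurable[Filtration.natural ξ hξ (n + 1)]
        fun ω => besselChain κ (fun i => ξ i ω) x n :=
      ih.mono ((Filtration.natural ξ hξ).mono n.le_succ) le_rfl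
    have hjump : Measurable[Filtration.natural ξ hξ (n + 1)] (ξ (n + 1)) :=
      (Filtration.stronglyAdapted_natural hξ (n + 1)).measurable
    exact (((hchain.sub hjump).pow_const 2).add_const _).sqrt

theorem measurable_besselChain (hξ : ∀ n, Measurable (ξ n)) (κ x : ℝ) (n : ℕ) :
    Measurable fun ω => besselChain κ (fun i => ξ i ω) x n :=
  (measurable_besselChain_natural (fun n => (hξ n).stronglyMeasurable) κ x n).mono
    ((Filtration.natural ξ _).le n) le_rfl

theorem integrable_besselChain_sq [IsFiniteMeasure P] (hκ : 0 < κ)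
    (hξ : ∀ n, Measurable (ξ n)) (hsq : ∀ n, Integrable (fun ω => ξ n ω ^ 2) P) (x : ℝ) (n : ℕ) :
    Integrable (fun ω => besselChain κ (fun i => ξ i ω) x n ^ 2) P := by
  induction n with
  | zero => exact integrable_const (μ := P) (x ^ 2)
  | succ n ih =>
    refine (((ih.add (hsq (n + 1))).const_mul 2).add (integrable_const (4 / κ))).mono'
      ((measurable_besselChain hξ κ x _).pow_const 2).aestronglyMeasurable
      (ae_of_all _ fun ω => ?_)
    rw [Real.norm_of_nonneg (sq_nonneg _), besselChain_sq hκ]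
    simpa only [sub_eq_add_neg, neg_sq, Pi.add_apply, add_le_add_iff_right] using
      add_sq_le (a := besselChain κ (fun i => ξ i ω) x n) (b := -ξ (n + 1) ω)

variable {ν : Measure ℝ} [IsProbabilityMeasure P]

theorem ae_exists_tendsto_atTop_besselChain (hκ : 0 < κ) (hξ : IsIIDSeq ξ ν P) {u : ℝ}
    (hu : 0 < u) (hpos : ν (Set.Iio (-u)) ≠ 0) (x : ℝ) :
    ∀ᵐ ω ∂P, ∃ θ : ℕ → ℕ, StrictMono θ ∧
      Tendsto (fun k => besselChain κ (fun i => ξ i ω) x (θ k)) atTop atTop := by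
  filter_upwards [ae_all_iff.2 fun N =>
    ae_frequently_forall_mem_Ioc hξ measurableSet_Iio hpos (N + 1)] with ω hruns
  have hlarge : ∀ N : ℕ, ∃ᶠ n in atTop,
      ((N + 1 : ℕ) : ℝ) * u ≤ besselChain κ (fun i => ξ i ω) x n := by
    refine fun N => frequently_atTop.2 fun a => ?_
    obtain ⟨j, hj, hrun⟩ := frequently_atTop.1 (hruns N) (a + 1)
    refine ⟨j * (N + 1) + (N + 1), by nlinarith,
      natCast_mul_le_besselChain hκ (Nat.mul_pos (by omega) N.succ_pos) fun i hi => ?_⟩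
    exact hrun i (by rwa [Nat.succ_mul])
  obtain ⟨θ, hθ, hle⟩ := extraction_forall_of_frequently hlarge
  exact ⟨θ, hθ, tendsto_atTop_mono hle
    ((tendsto_natCast_atTop_atTop.comp (tendsto_add_atTop_nat 1)).atTop_mul_const hu)⟩

theorem ae_frequently_le_or_exists_tendsto_besselChain (hκ : 0 < κ) (hξ : IsIIDSeq ξ ν P)
    {x : ℝ} {φ : ℝ → ℝ} (hφ : Measurable φ) (hφ0 : ∀ z, 4 / κ ≤ z → 0 ≤ φ z)
    (hint : ∀ n, Integrable (fun ω => φ (besselChain κ (fun i => ξ i ω) x (n + 1) ^ 2)) P)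
    {R : ℝ} (hdrift : ∀ y, 0 ≤ y → R < y → ∫ e, φ ((y - e) ^ 2 + 4 / κ) ∂ν ≤ φ (y ^ 2)) :
    ∀ᵐ ω ∂P, (∃ᶠ n in atTop, besselChain κ (fun i => ξ i ω) x n ≤ R) ∨
      ∃ l, Tendsto (fun n => φ (besselChain κ (fun i => ξ i ω) x n ^ 2)) atTop (𝓝 l) := by
  have hξ' : ∀ n, StronglyMeasurable (ξ n) := fun n => (hξ.measurable n).stronglyMeasurable
  let Y : ℕ → Ω → ℝ := fun n ω => besselChain κ (fun i => ξ i ω) x (n + 1)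
  let G : Filtration ℕ mΩ := ⟨fun n => Filtration.natural ξ hξ' (n + 1),
    fun i j h => (Filtration.natural ξ hξ').mono (Nat.succ_le_succ h),
    fun n => (Filtration.natural ξ hξ').le _⟩
  have hY : ∀ n, Measurable[G n] (Y n) := fun n => measurable_besselChain_natural hξ' κ x (n + 1)
  have hT : Measurable fun p : ℝ × ℝ => φ ((p.1 - p.2) ^ 2 + 4 / κ) :=
    hφ.comp (((measurable_fst.sub measurable_snd).pow_const 2).add_const _)
  have hstep : ∀ n s, MeasurableSet[G n] s → Disjoint s {ω | Y n ω ≤ R} →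
      ∫ ω in s, φ (Y (n + 1) ω ^ 2) ∂P ≤ ∫ ω in s, φ (Y n ω ^ 2) ∂P := by
    intro n s hs hdisj
    have hnext : ∀ ω, Y (n + 1) ω ^ 2 = (Y n ω - ξ (n + 2) ω) ^ 2 + 4 / κ := fun ω =>
      besselChain_sq hκ _ _ _
    obtain ⟨hTi, hfreeze⟩ := setIntegral_comp_prodMk_of_indep (P := P) (G.le n) (hY n)
      (hξ.measurable (n + 2)) (hξ.iIndepFun.indep_comap_natural_of_lt hξ' (Nat.lt_succ_self _)) hs
      hT (by simpa only [← hnext] using (hint (n + 1)).integrableOn)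
    simp only [hnext, hfreeze]
    refine setIntegral_mono_on hTi (hint n).integrableOn (G.le n _ hs) fun ω hω => ?_
    rw [hξ.map_eq]
    exact hdrift _ (besselChain_succ_nonneg _ _ _ _)
      (not_le.1 (Set.disjoint_left.1 hdisj hω))
  filter_upwards [ae_frequently_mem_or_exists_tendsto (G := G) (V := fun n ω => φ (Y n ω ^ 2))
    (B := fun n => {ω | Y n ω ≤ R})
    (fun n => (hφ.comp ((hY n).pow_const 2)).stronglyMeasurable) hint
    (fun n ω => hφ0 _ (four_div_le_besselChain_sq hκ _ _ _))
    (fun n => hY n measurableSet_Iic) hstep] with ω hω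
  refine hω.imp (fun h => ?_) fun ⟨l, hl⟩ => ⟨l, (tendsto_add_atTop_iff_nat 1).1 hl⟩
  exact (tendsto_add_atTop_nat 1).frequently h

theorem isRecurrentChain_besselChain_of_drift (hκ : 0 < κ) (hξ : IsIIDSeq ξ ν P)
    (hsq : Integrable (fun e => e ^ 2) ν) {u : ℝ} (hu : 0 < u)
    (hpos : ν (Set.Iio (-u)) ≠ 0) {φ : ℝ → ℝ} (hφ : Measurable φ)
    (hφ0 : ∀ z, 4 / κ ≤ z → 0 ≤ φ z) {C : ℝ} (hφC : ∀ z, 4 / κ ≤ z → φ z ≤ C + z)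
    (hφlim : Tendsto φ atTop atTop)
    (hdrift : ∀ᶠ y in atTop, ∫ e, φ ((y - e) ^ 2 + 4 / κ) ∂ν ≤ φ (y ^ 2)) :
    IsRecurrentChain P fun x m ω => besselChain κ (fun n => ξ n ω) x m := by
  obtain ⟨R, hR⟩ := eventually_atTop.1 hdrift
  have hξsq : ∀ n, Integrable (fun ω => ξ n ω ^ 2) P := fun n =>
    Integrable.comp_measurable (g := fun e : ℝ => e ^ 2) (hξ.map_eq n ▸ hsq) (hξ.measurable n)
  refine ⟨R, fun x _ => ?_⟩
  have hint : ∀ n, Integrable (fun ω => φ (besselChain κ (fun i => ξ i ω) x (n + 1) ^ 2)) P := by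
    intro n
    refine ((integrable_const C).add
      (integrable_besselChain_sq hκ hξ.measurable hξsq x (n + 1))).mono'
      (hφ.comp ((measurable_besselChain hξ.measurable κ x _).pow_const 2)).aestronglyMeasurable
      (ae_of_all _ fun ω => ?_)
    have hle := four_div_le_besselChain_sq hκ (fun i => ξ i ω) x n
    rw [Real.norm_of_nonneg (hφ0 _ hle)]
    exact hφC _ hle
  filter_upwards [ae_frequently_le_or_exists_tendsto_besselChain hκ hξ hφ hφ0 hint
      fun y _ hy => hR y hy.le,
    ae_exists_tendsto_atTop_besselChain hκ hξ hu hpos x] with ω hω ⟨θ, hθ, hYθ⟩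
  rcases hω with hle | ⟨l, hl⟩
  · exact hle.mp ((eventually_besselChain_nonneg κ (fun i => ξ i ω) x).mono fun n hn hle =>
      (abs_of_nonneg hn).trans_le hle)
  · have hφθ := hφlim.comp ((tendsto_pow_atTop two_ne_zero).comp hYθ)
    exact (not_tendsto_nhds_of_tendsto_atTop hφθ l (hl.comp hθ.tendsto_atTop)).elim

theorem isTransientChain_besselChain_of_forall_drift (hκ : 0 < κ) (hξ : IsIIDSeq ξ ν P) {u : ℝ}
    (hu : 0 < u) (hpos : ν (Set.Iio (-u)) ≠ 0) {φ : ℝ → ℝ} (hφ : Measurable φ)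
    (hφ0 : ∀ z, 0 ≤ z → 0 < φ z) (hanti : AntitoneOn φ (Set.Ici 0))
    (hφlim : Tendsto φ atTop (𝓝 0))
    (hdrift : ∀ y, 0 ≤ y → ∫ e, φ ((y - e) ^ 2 + 4 / κ) ∂ν ≤ φ (y ^ 2)) :
    IsTransientChain P fun x m ω => besselChain κ (fun n => ξ n ω) x m := by
  intro x _
  have hint : ∀ n, Integrable (fun ω => φ (besselChain κ (fun i => ξ i ω) x (n + 1) ^ 2)) P :=
    fun n => Integrable.of_bound
      (hφ.comp ((measurable_besselChain hξ.measurable κ x _).pow_const 2)).aestronglyMeasurable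
      (φ 0) (ae_of_all _ fun ω => by
        rw [Real.norm_of_nonneg (hφ0 _ (sq_nonneg _)).le]
        exact hanti Set.self_mem_Ici (Set.mem_Ici.2 (sq_nonneg _)) (sq_nonneg _))
  filter_upwards [ae_frequently_le_or_exists_tendsto_besselChain (R := -1) hκ hξ hφ
      (fun z hz => (hφ0 z (le_trans (by positivity) hz)).le) hint fun y hy _ => hdrift y hy,
    ae_exists_tendsto_atTop_besselChain hκ hξ hu hpos x] with ω hω ⟨θ, hθ, hYθ⟩
  have hnonneg := eventually_besselChain_nonneg κ (fun i => ξ i ω) x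
  obtain ⟨l, hl⟩ := hω.resolve_left (not_frequently.2 (hnonneg.mono fun n hn => by linarith))
  have hl0 : l = 0 := tendsto_nhds_unique (hl.comp hθ.tendsto_atTop)
    (hφlim.comp ((tendsto_pow_atTop two_ne_zero).comp hYθ))
  exact tendsto_abs_atTop_atTop.comp
    (tendsto_atTop_of_tendsto_antitoneOn_sq hφ0 hanti hnonneg (hl0 ▸ hl))

theorem isTransientChain_besselChain_of_drift (hκ : 0 < κ) (hξ : IsIIDSeq ξ ν P) {u : ℝ}
    (hu : 0 < u) (hpos : ν (Set.Iio (-u)) ≠ 0) {φ : ℝ → ℝ} (hφ : Measurable φ)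
    (hφ0 : ∀ z, 0 ≤ z → 0 < φ z) (hanti : AntitoneOn φ (Set.Ici 0))
    (hφlim : Tendsto φ atTop (𝓝 0))
    (hdrift : ∀ᶠ y in atTop, ∫ e, φ ((y - e) ^ 2 + 4 / κ) ∂ν ≤ φ (y ^ 2)) :
    IsTransientChain P fun x m ω => besselChain κ (fun n => ξ n ω) x m := by
  have := hξ.isProbabilityMeasure
  obtain ⟨R, hR⟩ := eventually_atTop.1 hdrift
  have hcap : 0 < φ (R ^ 2) := hφ0 _ (sq_nonneg R)
  have hlim := hφlim.min (tendsto_const_nhds (x := φ (R ^ 2)))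
  rw [min_eq_left hcap.le] at hlim
  -- Capping `φ` at `φ (R ^ 2)` makes the drift condition hold at every nonnegative `y`.
  refine isTransientChain_besselChain_of_forall_drift (φ := fun z => min (φ z) (φ (R ^ 2))) hκ hξ
    hu hpos (hφ.min measurable_const) (fun z hz => lt_min (hφ0 z hz) hcap)
    (fun a ha b hb hab => min_le_min_right _ (hanti ha hb hab)) hlim fun y hy => ?_
  have hbound : ∀ e, 0 ≤ (y - e) ^ 2 + 4 / κ := fun e => by positivity
  have hint : Integrable (fun e => φ ((y - e) ^ 2 + 4 / κ)) ν :=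
    Integrable.of_bound (hφ.comp (by fun_prop)).aestronglyMeasurable (φ 0) (ae_of_all _ fun e => by
      rw [Real.norm_of_nonneg (hφ0 _ (hbound e)).le]
      exact hanti Set.self_mem_Ici (hbound e) (hbound e))
  refine (integral_min_const_le hint _).trans (le_min ?_ (min_le_right _ _))
  rcases le_total R y with h | h
  · exact (min_le_left _ _).trans (hR y h)
  · exact (min_le_right _ _).trans
      (hanti (sq_nonneg y) (sq_nonneg R) (pow_le_pow_left₀ hy h 2))

end Chain

section StepError

theorem abs_log_one_add_sub_le {x : ℝ} (hx : |x| ≤ 1 / 2) :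
    |Real.log (1 + x) - (x - x ^ 2 / 2)| ≤ 2 * |x| ^ 3 := by
  have h := Real.abs_log_sub_add_sum_range_le (x := -x) (by rw [abs_neg]; linarith) 2
  simp only [Finset.sum_range_succ, Finset.sum_range_zero, abs_neg, sub_neg_eq_add] at h
  norm_num at h
  calc |Real.log (1 + x) - (x - x ^ 2 / 2)|
      = |-x + x ^ 2 / 2 + Real.log (1 + x)| := by congr 1; ring
    _ ≤ |x| ^ 3 / (1 - |x|) := h
    _ ≤ 2 * |x| ^ 3 := by
      rw [div_le_iff₀ (by linarith)]
      nlinarith [pow_nonneg (abs_nonneg x) 3]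

theorem one_add_rpow_neg_le {x ε : ℝ} (hx : |x| ≤ 1 / 2) (hε : 0 ≤ ε) (hε' : ε ≤ 1 / 2) :
    (1 + x) ^ (-ε) ≤ 1 - ε * x + ε * (1 / 2 + 2 * |x| + 4 * ε) * x ^ 2 := by
  have hx3 : |x| ^ 3 = |x| * x ^ 2 := by rw [pow_succ', sq_abs]
  have hx2 : x ^ 2 ≤ |x| / 2 := by rw [← sq_abs]; nlinarith [abs_nonneg x]
  have h0 := abs_nonneg x
  set w := -x + x ^ 2 / 2 + 2 * |x| ^ 3 with hw
  have hlog : -Real.log (1 + x) ≤ w := by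
    linarith [(abs_le.1 (abs_log_one_add_sub_le hx)).1]
  have hwx : |w| ≤ 2 * |x| := by
    rw [abs_le]
    constructor <;> nlinarith [neg_abs_le x, le_abs_self x, sq_nonneg x]
  have hu : |ε * w| ≤ 1 := by
    rw [abs_mul, abs_of_nonneg hε]
    nlinarith [abs_nonneg w]
  have hw2 : w ^ 2 ≤ 4 * x ^ 2 := by
    rw [← sq_abs w, ← sq_abs x]
    nlinarith [abs_nonneg w]
  calc (1 + x) ^ (-ε) = Real.exp (ε * -Real.log (1 + x)) := by
        rw [Real.rpow_def_of_pos (by linarith [neg_abs_le x])]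
        congr 1
        ring
    _ ≤ Real.exp (ε * w) := Real.exp_le_exp.2 (mul_le_mul_of_nonneg_left hlog hε)
    _ ≤ 1 + ε * w + (ε * w) ^ 2 := by
        linarith [(abs_le.1 (Real.abs_exp_sub_one_sub_id_le hu)).2]
    _ ≤ 1 - ε * x + ε * (1 / 2 + 2 * |x| + 4 * ε) * x ^ 2 := by
        rw [hw, hx3] at *
        nlinarith [mul_le_mul_of_nonneg_left hw2 (sq_nonneg ε)]

theorem sqrt_one_add_le {v : ℝ} (hv : -1 ≤ v) :
    √(1 + v) ≤ 1 + v / 2 - v ^ 2 / 8 + v ^ 3 / 16 := by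
  have hpos : 0 ≤ 1 + v / 2 - v ^ 2 / 8 + v ^ 3 / 16 := by
    nlinarith [sq_nonneg (v + 1), sq_nonneg (v - 2), mul_nonneg (neg_le_iff_add_nonneg.1 hv)
      (sq_nonneg (v - 2))]
  rw [Real.sqrt_le_left hpos]
  have hrem : 0 ≤ v ^ 4 * ((v - 2) ^ 2 + 16) / 256 := by positivity
  calc 1 + v ≤ 1 + v + v ^ 4 * ((v - 2) ^ 2 + 16) / 256 := le_add_of_nonneg_right hrem
    _ = (1 + v / 2 - v ^ 2 / 8 + v ^ 3 / 16) ^ 2 := by ring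

/-- The common error term of the second-order expansions of the Lyapunov functions below, for a
jump of relative size `t = e / y` and an additive constant of relative size `s = c / y ^ 2`. It is
of third order for small steps but never exceeds `t ^ 2 + s`, so that a finite second moment
controls it. -/
noncomputable def stepError (t s : ℝ) : ℝ :=
  min (|t| + s) 1 * (t ^ 2 + s)

variable {t s : ℝ}

theorem stepError_nonneg (hs : 0 ≤ s) : 0 ≤ stepError t s := by
  unfold stepError
  positivity

theorem stepError_le (hs : 0 ≤ s) : stepError t s ≤ t ^ 2 + s :=
  mul_le_of_le_one_left (by positivity) (min_le_right _ _)

theorem mul_le_stepError (hs : 0 ≤ s) {a : ℝ} (ha : a ≤ 1) (hts : a ≤ |t| + s) :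
    a * (t ^ 2 + s) ≤ stepError t s :=
  mul_le_mul_of_nonneg_right (le_min hts ha) (by positivity)

theorem abs_sq_sub_le_stepError (hs : 0 ≤ s) (hts : |t| + s ≤ 1) :
    |(-2 * t + t ^ 2 + s) ^ 2 - 4 * t ^ 2| ≤ 5 * stepError t s := by
  have ht : t ^ 2 ≤ |t| := by rw [← sq_abs]; nlinarith [abs_nonneg t]
  have hts2 : 0 ≤ t ^ 2 + s := by positivity
  rw [stepError, min_eq_left hts]
  calc |(-2 * t + t ^ 2 + s) ^ 2 - 4 * t ^ 2|
      = |-4 * t + (t ^ 2 + s)| * (t ^ 2 + s) := by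
        nth_rw 2 [← abs_of_nonneg hts2]
        rw [← abs_mul]
        congr 1
        ring
    _ ≤ (4 * |t| + (|t| + s)) * (t ^ 2 + s) := by
        gcongr
        refine (abs_add_le _ _).trans ?_
        rw [abs_mul, abs_of_nonneg hts2]
        norm_num
        linarith
    _ ≤ 5 * ((|t| + s) * (t ^ 2 + s)) := by nlinarith

theorem abs_relStep_le (hs : 0 ≤ s) (hts : |t| + s ≤ 1) :
    |-2 * t + t ^ 2 + s| ≤ 3 * (|t| + s) := by
  have ht : t ^ 2 ≤ |t| := by rw [← sq_abs]; nlinarith [abs_nonneg t]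
  rw [abs_le]
  constructor <;> nlinarith [neg_abs_le t, le_abs_self t, sq_nonneg t]

theorem abs_relStep_pow_three_le (hs : 0 ≤ s) (hts : |t| + s ≤ 1) :
    |-2 * t + t ^ 2 + s| ^ 3 ≤ 27 * stepError t s := by
  have hsq : (-2 * t + t ^ 2 + s) ^ 2 ≤ 9 * (t ^ 2 + s) := by
    linarith [(abs_le.1 (abs_sq_sub_le_stepError hs hts)).2, stepError_le (t := t) hs]
  calc |-2 * t + t ^ 2 + s| ^ 3 = |-2 * t + t ^ 2 + s| * (-2 * t + t ^ 2 + s) ^ 2 := by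
        rw [pow_succ', sq_abs]
    _ ≤ 3 * (|t| + s) * (9 * (t ^ 2 + s)) := by gcongr; exact abs_relStep_le hs hts
    _ = 27 * stepError t s := by rw [stepError, min_eq_left hts]; ring

theorem log_one_sub_sq_add_le (hs : 0 < s) :
    Real.log ((1 - t) ^ 2 + s) ≤ -2 * t - t ^ 2 + s + 60 * stepError t s := by
  have hR := stepError_nonneg (t := t) hs.le
  have hq : (1 - t) ^ 2 + s = 1 + (-2 * t + t ^ 2 + s) := by ring
  rcases le_total (|t| + s) (1 / 6) with hts | hts
  · have hts1 : |t| + s ≤ 1 := by linarith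
    have hlog := (abs_le.1 (abs_log_one_add_sub_le
      ((abs_relStep_le hs.le hts1).trans (by linarith)))).2
    have hsq := (abs_le.1 (abs_sq_sub_le_stepError hs.le hts1)).1
    have hcube := abs_relStep_pow_three_le hs.le hts1
    rw [hq]
    linarith
  · have hlog := Real.log_le_sub_one_of_pos (x := (1 - t) ^ 2 + s) (by positivity)
    have hlarge := mul_le_stepError hs.le (by norm_num) hts
    linarith

theorem four_mul_sq_sub_le_log_sq (hs : 0 ≤ s) (hts : |t| + s ≤ 1 / 6) :
    4 * t ^ 2 - 86 * stepError t s ≤ Real.log ((1 - t) ^ 2 + s) ^ 2 := by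
  have hts1 : |t| + s ≤ 1 := by linarith
  have hq : (1 - t) ^ 2 + s = 1 + (-2 * t + t ^ 2 + s) := by ring
  have hsq := (abs_le.1 (abs_sq_sub_le_stepError hs hts1)).1
  have hcube := abs_relStep_pow_three_le hs hts1
  have hq2 := (abs_relStep_le hs hts1).trans (by linarith : _ ≤ (1 : ℝ) / 2)
  rw [hq]
  set q := -2 * t + t ^ 2 + s
  have hlog : |Real.log (1 + q) - q| ≤ 3 / 2 * |q| ^ 2 := by
    have h := abs_le.1 (abs_log_one_add_sub_le hq2)
    have h3 : |q| ^ 3 ≤ |q| ^ 2 / 2 := by nlinarith [sq_nonneg |q|]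
    rw [abs_le]
    constructor <;> nlinarith [sq_abs q]
  have hcross : |q * (Real.log (1 + q) - q)| ≤ 3 / 2 * |q| ^ 3 := by
    rw [abs_mul]
    calc |q| * |Real.log (1 + q) - q| ≤ |q| * (3 / 2 * |q| ^ 2) := by gcongr
      _ = 3 / 2 * |q| ^ 3 := by ring
  nlinarith [neg_abs_le (q * (Real.log (1 + q) - q)), sq_nonneg (Real.log (1 + q) - q)]

theorem log_pow_three_le (hs : 0 ≤ s) (hts : |t| + s ≤ 1 / 6) :
    Real.log ((1 - t) ^ 2 + s) ^ 3 ≤ 27 * stepError t s := by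
  have hts1 : |t| + s ≤ 1 := by linarith
  have hq2 := (abs_relStep_le hs hts1).trans (by linarith : _ ≤ (1 : ℝ) / 2)
  have hlog : Real.log ((1 - t) ^ 2 + s) ≤ |-2 * t + t ^ 2 + s| := by
    have hpos : 0 < (1 - t) ^ 2 + s := by nlinarith [abs_le.1 hq2]
    linarith [Real.log_le_sub_one_of_pos hpos, le_abs_self (-2 * t + t ^ 2 + s)]
  have hodd : Odd 3 := by decide
  exact (hodd.strictMono_pow.monotone hlog).trans (abs_relStep_pow_three_le hs hts1)

theorem sqrt_sq_add_le {l D : ℝ} (hl : 0 < l) (hD : 0 ≤ l ^ 2 + D) :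
    √(l ^ 2 + D) ≤ l + D / (2 * l) - D ^ 2 / (8 * l ^ 3) + D ^ 3 / (16 * l ^ 5) := by
  have hv : -1 ≤ D / l ^ 2 := by
    rw [le_div_iff₀ (by positivity)]
    linarith
  calc √(l ^ 2 + D) = √(l ^ 2 * (1 + D / l ^ 2)) := by
        congr 1
        field_simp
    _ = l * √(1 + D / l ^ 2) := by rw [Real.sqrt_mul (sq_nonneg l), Real.sqrt_sq hl.le]
    _ ≤ l * (1 + D / l ^ 2 / 2 - (D / l ^ 2) ^ 2 / 8 + (D / l ^ 2) ^ 3 / 16) := by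
        gcongr
        exact sqrt_one_add_le hv
    _ = l + D / (2 * l) - D ^ 2 / (8 * l ^ 3) + D ^ 3 / (16 * l ^ 5) := by
        field_simp

theorem sqrt_sq_add_le_add_div {l D : ℝ} (hl : 0 < l) (hD : 0 ≤ l ^ 2 + D) :
    √(l ^ 2 + D) ≤ l + D / (2 * l) := by
  rw [Real.sqrt_le_iff]
  constructor
  · rw [show l + D / (2 * l) = (l ^ 2 + (l ^ 2 + D)) / (2 * l) by field_simp; ring]
    positivity
  · rw [show (l + D / (2 * l)) ^ 2 = l ^ 2 + D + (D / (2 * l)) ^ 2 by field_simp; ring]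
    exact le_add_of_nonneg_right (sq_nonneg _)

theorem sqrt_sq_add_log_le (hs : 0 < s) {l : ℝ} (hl : 1 ≤ l)
    (hD : 0 ≤ l ^ 2 + Real.log ((1 - t) ^ 2 + s)) :
    √(l ^ 2 + Real.log ((1 - t) ^ 2 + s)) ≤
      l + (-2 * t - t ^ 2 + s) / (2 * l) - t ^ 2 / (2 * l ^ 3) + 60 * stepError t s := by
  have hR := stepError_nonneg (t := t) hs.le
  have hl0 : 0 < l := by linarith
  have hlog : Real.log ((1 - t) ^ 2 + s) / (2 * l) ≤
      (-2 * t - t ^ 2 + s) / (2 * l) + 30 * stepError t s := by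
    calc Real.log ((1 - t) ^ 2 + s) / (2 * l)
        ≤ (-2 * t - t ^ 2 + s + 60 * stepError t s) / (2 * l) := by
          gcongr
          exact log_one_sub_sq_add_le hs
      _ = (-2 * t - t ^ 2 + s) / (2 * l) + 30 * stepError t s / l := by
          field_simp
          ring
      _ ≤ _ := by
          gcongr
          exact div_le_self (by positivity) hl
  rcases le_total (|t| + s) (1 / 6) with hts | hts
  · have hD2 : t ^ 2 / (2 * l ^ 3) - 11 * stepError t s ≤
        Real.log ((1 - t) ^ 2 + s) ^ 2 / (8 * l ^ 3) := by
      calc t ^ 2 / (2 * l ^ 3) - 11 * stepError t s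
          ≤ t ^ 2 / (2 * l ^ 3) - 11 * stepError t s / l ^ 3 := by
            gcongr
            exact div_le_self (by positivity) (one_le_pow₀ hl)
        _ = (4 * t ^ 2 - 88 * stepError t s) / (8 * l ^ 3) := by
            field_simp
            ring
        _ ≤ _ := by
            gcongr
            linarith [four_mul_sq_sub_le_log_sq hs.le hts]
    have hD3 : Real.log ((1 - t) ^ 2 + s) ^ 3 / (16 * l ^ 5) ≤ 2 * stepError t s := by
      rw [div_le_iff₀ (by positivity)]
      nlinarith [log_pow_three_le hs.le hts, one_le_pow₀ hl (n := 5)]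
    linarith [sqrt_sq_add_le hl0 hD]
  · have hlarge := mul_le_stepError hs.le (by norm_num) hts
    have ht2 : t ^ 2 / (2 * l ^ 3) ≤ t ^ 2 / 2 := by
      gcongr
      linarith [one_le_pow₀ hl (n := 3)]
    linarith [sqrt_sq_add_le_add_div hl0 hD]

end StepError

section StandardLaw

/-- `ν` is the law of a square-integrable random variable with mean `0` and variance `1`. -/
structure IsStandardLaw (ν : Measure ℝ) : Prop where
  memLp : MemLp id 2 ν
  integral_eq : ∫ e, e ∂ν = 0
  integral_sq_eq : ∫ e, e ^ 2 ∂ν = 1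

variable {ν : Measure ℝ}

theorem IsStandardLaw.integrable_sq (hν : IsStandardLaw ν) : Integrable (fun e => e ^ 2) ν :=
  hν.memLp.integrable_sq

theorem measurable_stepError (y c : ℝ) : Measurable fun e => stepError (e / y) (c / y ^ 2) := by
  unfold stepError
  fun_prop

theorem sq_mul_stepError_div {y : ℝ} (hy : 0 < y) (c e : ℝ) :
    y ^ 2 * stepError (e / y) (c / y ^ 2) = min (|e| / y + c / y ^ 2) 1 * (e ^ 2 + c) := by
  rw [stepError, abs_div, abs_of_pos hy]
  field_simp

variable [IsProbabilityMeasure ν]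

theorem IsStandardLaw.integrable_id (hν : IsStandardLaw ν) : Integrable (fun e => e) ν :=
  hν.memLp.integrable one_le_two

theorem IsStandardLaw.exists_measure_Iio_neg_ne_zero (hν : IsStandardLaw ν) :
    ∃ u : ℝ, 0 < u ∧ ν (Set.Iio (-u)) ≠ 0 :=
  _root_.exists_measure_Iio_neg_ne_zero hν.integrable_id hν.integral_eq
    (hν.integral_sq_eq ▸ one_ne_zero)

theorem IsStandardLaw.integrable_stepError (hν : IsStandardLaw ν) {c : ℝ} (hc : 0 ≤ c) (y : ℝ) :
    Integrable (fun e => stepError (e / y) (c / y ^ 2)) ν := by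
  have hs : 0 ≤ c / y ^ 2 := by positivity
  refine ((hν.integrable_sq.div_const (y ^ 2)).add (integrable_const (c / y ^ 2))).mono'
    (measurable_stepError y c).aestronglyMeasurable (ae_of_all _ fun e => ?_)
  rw [Real.norm_of_nonneg (stepError_nonneg hs)]
  exact (stepError_le hs).trans_eq (by rw [div_pow]; rfl)

theorem IsStandardLaw.integral_le_of_le_quadratic (hν : IsStandardLaw ν) {f r : ℝ → ℝ}
    (hf : ∀ e, 0 ≤ f e) (hr : Integrable r ν) {a b d k : ℝ}
    (hle : ∀ e, f e ≤ a + b * e + d * e ^ 2 + k * r e) :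
    ∫ e, f e ∂ν ≤ a + d + k * ∫ e, r e ∂ν := by
  have haff : Integrable (fun e => a + b * e) ν :=
    (integrable_const a).add (hν.integrable_id.const_mul b)
  have hquad : Integrable (fun e => a + b * e + d * e ^ 2) ν :=
    haff.add (hν.integrable_sq.const_mul d)
  calc ∫ e, f e ∂ν ≤ ∫ e, (a + b * e + d * e ^ 2 + k * r e) ∂ν :=
        integral_mono_of_nonneg (ae_of_all _ hf) (hquad.add (hr.const_mul k)) (ae_of_all _ hle)
    _ = a + d + k * ∫ e, r e ∂ν := by
        rw [integral_add hquad (hr.const_mul k), integral_add haff (hν.integrable_sq.const_mul d),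
          integral_add (integrable_const a) (hν.integrable_id.const_mul b), integral_const_mul,
          integral_const_mul, integral_const_mul, hν.integral_eq, hν.integral_sq_eq]
        simp

theorem IsStandardLaw.tendsto_sq_mul_integral_stepError (hν : IsStandardLaw ν) {c : ℝ}
    (hc : 0 ≤ c) :
    Tendsto (fun y => y ^ 2 * ∫ e, stepError (e / y) (c / y ^ 2) ∂ν) atTop (𝓝 0) := by
  have hlim : Tendsto (fun y => ∫ e, min (|e| / y + c / y ^ 2) 1 * (e ^ 2 + c) ∂ν) atTop
      (𝓝 (∫ _, (0 : ℝ) ∂ν)) := by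
    refine tendsto_integral_filter_of_dominated_convergence (fun e => e ^ 2 + c)
      (Eventually.of_forall fun y => by fun_prop) ?_
      (hν.integrable_sq.add (integrable_const c)) (ae_of_all _ fun e => ?_)
    · filter_upwards [eventually_gt_atTop 0] with y hy
      refine ae_of_all _ fun e => ?_
      rw [Real.norm_of_nonneg (by positivity)]
      exact mul_le_of_le_one_left (by positivity) (min_le_right _ _)
    · have hsmall : Tendsto (fun y : ℝ => |e| / y + c / y ^ 2) atTop (𝓝 (0 + 0)) :=
        (tendsto_const_nhds.div_atTop tendsto_id).add
          (tendsto_const_nhds.div_atTop (tendsto_pow_atTop two_ne_zero))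
      simpa using (hsmall.min (tendsto_const_nhds (x := (1 : ℝ)))).mul_const (e ^ 2 + c)
  rw [integral_zero] at hlim
  refine hlim.congr' ?_
  filter_upwards [eventually_gt_atTop 0] with y hy
  simp only [← sq_mul_stepError_div hy, integral_const_mul]

theorem sq_mul_stepError_div_le {p c y : ℝ} (hp2 : 2 ≤ p) (hp3 : p ≤ 3) (hc : 0 ≤ c) (hy : 1 ≤ y)
    (e : ℝ) :
    y ^ 2 * stepError (e / y) (c / y ^ 2) ≤ y ^ (2 - p) * (|e| + (1 + c)) ^ p := by
  have hy0 : 0 < y := by linarith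
  set a := min (|e| / y + c / y ^ 2) 1
  have ha0 : 0 ≤ a := by positivity
  have ha : a ≤ (|e| + (1 + c)) / y := by
    refine (min_le_left _ _).trans ?_
    rw [div_add_div _ _ hy0.ne' (by positivity), div_le_div_iff₀ (by positivity) hy0]
    nlinarith [mul_le_mul_of_nonneg_left hy hc, mul_pos hy0 hy0]
  have hpow : a ≤ ((|e| + (1 + c)) / y) ^ (p - 2) :=
    (Real.self_le_rpow_of_le_one ha0 (min_le_right _ _) (by linarith)).trans
      (Real.rpow_le_rpow ha0 ha (by linarith))
  calc y ^ 2 * stepError (e / y) (c / y ^ 2) = a * (e ^ 2 + c) := sq_mul_stepError_div hy0 c e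
    _ ≤ ((|e| + (1 + c)) / y) ^ (p - 2) * (|e| + (1 + c)) ^ 2 := by
        gcongr
        nlinarith [sq_abs e, abs_nonneg e]
    _ = y ^ (2 - p) * (|e| + (1 + c)) ^ p := by
        rw [Real.div_rpow (by positivity) hy0.le, ← Real.rpow_natCast (|e| + (1 + c)) 2,
          div_mul_eq_mul_div, ← Real.rpow_add (by positivity), div_eq_mul_inv,
          ← Real.rpow_neg hy0.le]
        norm_num
        ring

theorem exists_integral_stepError_le {p c : ℝ} (hp2 : 2 ≤ p) (hp3 : p ≤ 3) (hc : 0 ≤ c)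
    (hmom : MemLp id (ENNReal.ofReal p) ν) :
    ∃ C, ∀ y, 1 ≤ y → y ^ 2 * ∫ e, stepError (e / y) (c / y ^ 2) ∂ν ≤ C * y ^ (2 - p) := by
  have hint : Integrable (fun e => (|e| + (1 + c)) ^ p) ν := by
    have hmem : MemLp (fun e => |e| + (1 + c)) (ENNReal.ofReal p) ν :=
      hmom.abs.add (memLp_const _)
    have hpow := hmem.integrable_norm_rpow (by simpa using by linarith) ENNReal.ofReal_ne_top
    rw [ENNReal.toReal_ofReal (by linarith)] at hpow
    refine hpow.congr (ae_of_all _ fun e => ?_)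
    beta_reduce
    rw [Real.norm_of_nonneg (by positivity)]
  refine ⟨∫ e, (|e| + (1 + c)) ^ p ∂ν, fun y hy => ?_⟩
  calc y ^ 2 * ∫ e, stepError (e / y) (c / y ^ 2) ∂ν
      = ∫ e, y ^ 2 * stepError (e / y) (c / y ^ 2) ∂ν := (integral_const_mul _ _).symm
    _ ≤ ∫ e, y ^ (2 - p) * (|e| + (1 + c)) ^ p ∂ν :=
        integral_mono_of_nonneg
          (ae_of_all _ fun e => mul_nonneg (by positivity) (stepError_nonneg (by positivity)))
          (hint.const_mul _) (ae_of_all _ fun e => sq_mul_stepError_div_le hp2 hp3 hc hy e)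
    _ = (∫ e, (|e| + (1 + c)) ^ p ∂ν) * y ^ (2 - p) := by rw [integral_const_mul, mul_comm]

end StandardLaw

section LogDrift

variable {ν : Measure ℝ} [IsProbabilityMeasure ν]

theorem log_sub_sq_add {y : ℝ} (hy : y ≠ 0) {c : ℝ} (hc : 0 < c) (e : ℝ) :
    Real.log ((y - e) ^ 2 + c) =
      Real.log (y ^ 2) + Real.log ((1 - e / y) ^ 2 + c / y ^ 2) := by
  rw [← Real.log_mul (by positivity) (by positivity)]
  congr 1
  field_simp

theorem IsStandardLaw.eventually_integral_log_le (hν : IsStandardLaw ν) {c : ℝ} (hc : 0 < c)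
    (hc1 : c < 1) :
    ∀ᶠ y in atTop, ∫ e, (Real.log ((y - e) ^ 2 + c) - Real.log c) ∂ν ≤
      Real.log (y ^ 2) - Real.log c := by
  filter_upwards [eventually_gt_atTop 0,
    (hν.tendsto_sq_mul_integral_stepError hc.le).eventually_le_const
      (show 0 < (1 - c) / 60 by linarith)] with y hy hI
  set I := ∫ e, stepError (e / y) (c / y ^ 2) ∂ν
  have hexp : ∀ e, Real.log ((y - e) ^ 2 + c) - Real.log c ≤
      (Real.log (y ^ 2) - Real.log c + c / y ^ 2) + -2 / y * e + -1 / y ^ 2 * e ^ 2 +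
        60 * stepError (e / y) (c / y ^ 2) := by
    intro e
    rw [log_sub_sq_add hy.ne' hc]
    have h := log_one_sub_sq_add_le (t := e / y) (s := c / y ^ 2) (by positivity)
    rw [div_pow] at h
    linear_combination h
  have hint := hν.integral_le_of_le_quadratic
    (fun e => sub_nonneg.2 (Real.log_le_log hc (le_add_of_nonneg_left (sq_nonneg _))))
    (hν.integrable_stepError hc.le y) hexp
  have hdrift : (c - 1) / y ^ 2 + 60 * I ≤ 0 := by
    rw [div_add' _ _ _ (by positivity)]
    exact div_nonpos_of_nonpos_of_nonneg (by linarith) (sq_nonneg y)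
  linear_combination hint + hdrift

theorem tendsto_sqrt_log_sq_pow_mul_rpow_neg {r : ℝ} (hr : 0 < r) :
    Tendsto (fun y : ℝ => √(Real.log (y ^ 2)) ^ 3 * y ^ (-r)) atTop (𝓝 0) := by
  have hlim := ((isLittleO_log_rpow_rpow_atTop (3 / 2) hr).tendsto_div_nhds_zero).const_mul
    ((2 : ℝ) ^ (3 / 2 : ℝ))
  rw [mul_zero] at hlim
  refine hlim.congr' ?_
  filter_upwards [eventually_ge_atTop 1] with y hy
  have hlog := Real.log_nonneg hy
  rw [Real.log_pow, Real.sqrt_eq_rpow, ← Real.rpow_natCast, ← Real.rpow_mul (by positivity),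
    Real.rpow_neg (by linarith), Nat.cast_ofNat, Real.mul_rpow zero_le_two hlog]
  norm_num
  ring

theorem IsStandardLaw.eventually_integral_sqrt_log_le (hν : IsStandardLaw ν) {p : ℝ} (hp2 : 2 < p)
    (hp3 : p ≤ 3) (hmom : MemLp id (ENNReal.ofReal p) ν) :
    ∀ᶠ y in atTop, ∫ e, √(Real.log ((y - e) ^ 2 + 1)) ∂ν ≤ √(Real.log (y ^ 2)) := by
  obtain ⟨C, hC⟩ := exists_integral_stepError_le hp2.le hp3 zero_le_one hmom
  have hlim := (tendsto_sqrt_log_sq_pow_mul_rpow_neg (sub_pos.2 hp2)).const_mul (120 * C)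
  rw [mul_zero] at hlim
  have hl : Tendsto (fun y : ℝ => √(Real.log (y ^ 2))) atTop atTop :=
    Real.tendsto_sqrt_atTop.comp (Real.tendsto_log_atTop.comp (tendsto_pow_atTop two_ne_zero))
  filter_upwards [eventually_ge_atTop 1, hl.eventually_ge_atTop 1,
    hlim.eventually_le_const one_pos] with y hy hl1 hlog
  have hy0 : 0 < y := by linarith
  specialize hC y hy
  rw [neg_sub] at hlog
  set l := √(Real.log (y ^ 2))
  set I := ∫ e, stepError (e / y) (1 / y ^ 2) ∂ν
  have : 0 < l := by linarith
  have hexp : ∀ e, √(Real.log ((y - e) ^ 2 + 1)) ≤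
      (l + 1 / (2 * l * y ^ 2)) + -1 / (l * y) * e +
        (-1 / (2 * l * y ^ 2) - 1 / (2 * l ^ 3 * y ^ 2)) * e ^ 2 +
        60 * stepError (e / y) (1 / y ^ 2) := by
    intro e
    have hlsq : l ^ 2 = Real.log (y ^ 2) := Real.sq_sqrt (Real.log_nonneg (one_le_pow₀ hy))
    have hnonneg : 0 ≤ Real.log ((y - e) ^ 2 + 1) :=
      Real.log_nonneg (le_add_of_nonneg_left (sq_nonneg _))
    rw [log_sub_sq_add hy0.ne' one_pos, ← hlsq] at hnonneg ⊢
    refine (sqrt_sq_add_log_le (by positivity) hl1 hnonneg).trans_eq ?_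
    field_simp
    ring
  have hint := hν.integral_le_of_le_quadratic (fun e => Real.sqrt_nonneg _)
    (hν.integrable_stepError zero_le_one y) hexp
  have hdrift : 60 * I ≤ 1 / (2 * l ^ 3 * y ^ 2) := by
    rw [le_div_iff₀ (by positivity)]
    linarith [mul_le_mul_of_nonneg_left hC (show 0 ≤ 120 * l ^ 3 by positivity)]
  linear_combination hint + hdrift

end LogDrift

section ScaleMixture

/-- The basic function `z ↦ (b / (b + z)) ^ ε` of scale `b`, evaluated along the chain at the
squared position `z`. It decreases from `1` at `z = 0` to `0` at infinity. -/
noncomputable def scaleKernel (ε b z : ℝ) : ℝ :=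
  (b / (b + z)) ^ ε

/-- The average of the functions `scaleKernel ε b` over the scales `b`, with weights given by the
measure `μ`. It is the Lyapunov function of the transient regime. -/
noncomputable def scaleMixture (ε : ℝ) (μ : Measure ℝ) (z : ℝ) : ℝ :=
  ∫ b, scaleKernel ε b z ∂μ

variable {ε b z : ℝ}

theorem scaleKernel_pos (hb : 0 < b) (hz : 0 ≤ z) : 0 < scaleKernel ε b z :=
  Real.rpow_pos_of_pos (by positivity) ε

theorem scaleKernel_le_one (hε : 0 ≤ ε) (hb : 0 < b) (hz : 0 ≤ z) : scaleKernel ε b z ≤ 1 :=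
  Real.rpow_le_one (by positivity) ((div_le_one (by positivity)).2 (by linarith)) hε

theorem antitoneOn_scaleKernel (hε : 0 ≤ ε) (hb : 0 < b) :
    AntitoneOn (scaleKernel ε b) (Set.Ici 0) := by
  intro z (hz : 0 ≤ z) z' (hz' : 0 ≤ z') hzz
  unfold scaleKernel
  gcongr

theorem tendsto_scaleKernel (hε : 0 < ε) (b : ℝ) : Tendsto (scaleKernel ε b) atTop (𝓝 0) := by
  have hbase : Tendsto (fun z => b / (b + z)) atTop (𝓝 0) :=
    tendsto_const_nhds.div_atTop (tendsto_atTop_add_const_left _ _ tendsto_id)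
  exact Real.zero_rpow hε.ne' ▸ hbase.rpow_const (Or.inr hε.le)

theorem measurable_scaleKernel (ε : ℝ) : Measurable fun p : ℝ × ℝ => scaleKernel ε p.2 p.1 :=
  (measurable_snd.div (measurable_snd.add measurable_fst)).pow_const ε

theorem scaleKernel_sub_sq_add (hb : 0 < b) {y c e : ℝ} (hy : y ≠ 0)
    (hx : 0 < 1 + y ^ 2 / (b + y ^ 2) * (-2 * (e / y) + (e / y) ^ 2 + c / y ^ 2)) :
    scaleKernel ε b ((y - e) ^ 2 + c) = scaleKernel ε b (y ^ 2) *
      (1 + y ^ 2 / (b + y ^ 2) * (-2 * (e / y) + (e / y) ^ 2 + c / y ^ 2)) ^ (-ε) := by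
  have hfactor : b + ((y - e) ^ 2 + c) = (b + y ^ 2) *
      (1 + y ^ 2 / (b + y ^ 2) * (-2 * (e / y) + (e / y) ^ 2 + c / y ^ 2)) := by
    field_simp
    ring
  rw [scaleKernel, hfactor, ← div_div, Real.div_rpow (by positivity) hx.le,
    Real.rpow_neg hx.le, div_eq_mul_inv, scaleKernel]

theorem one_add_mul_rpow_neg_le {t s ρ : ℝ} (hs : 0 ≤ s) (hts : |t| + s ≤ 1 / 6) (hρ0 : 0 ≤ ρ)
    (hρ1 : ρ ≤ 1) (hε : 0 ≤ ε) (hε' : ε ≤ 1 / 2) :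
    (1 + ρ * (-2 * t + t ^ 2 + s)) ^ (-ε) ≤
      1 + ε * ρ * (2 * t + (1 + 16 * ε) * t ^ 2 - s + 67 * stepError t s) := by
  have hts1 : |t| + s ≤ 1 := by linarith
  have hq := (abs_relStep_le hs hts1).trans (by linarith : _ ≤ (1 : ℝ) / 2)
  have hsq := (abs_le.1 (abs_sq_sub_le_stepError hs hts1)).2
  have hcube := abs_relStep_pow_three_le hs hts1
  have hR := stepError_nonneg (t := t) hs
  set q := -2 * t + t ^ 2 + s with hq_def
  have hρq : |ρ * q| ≤ |q| := by
    rw [abs_mul, abs_of_nonneg hρ0]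
    exact mul_le_of_le_one_left (abs_nonneg q) hρ1
  calc (1 + ρ * q) ^ (-ε)
      ≤ 1 - ε * (ρ * q) + ε * (1 / 2 + 2 * |ρ * q| + 4 * ε) * (ρ * q) ^ 2 :=
        one_add_rpow_neg_le (hρq.trans hq) hε hε'
    _ ≤ 1 - ε * (ρ * q) + ε * (1 / 2 + 2 * |q| + 4 * ε) * (ρ * q ^ 2) := by
        rw [mul_pow]
        gcongr
        exact pow_le_of_le_one hρ0 hρ1 two_ne_zero
    _ = 1 + ε * ρ * (-q + (1 / 2 + 4 * ε) * q ^ 2 + 2 * |q| ^ 3) := by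
        rw [pow_succ' |q|, sq_abs]
        ring
    _ ≤ 1 + ε * ρ * (2 * t + (1 + 16 * ε) * t ^ 2 - s + 67 * stepError t s) := by
        gcongr 1 + ε * ρ * ?_
        rw [hq_def] at hsq hcube ⊢
        nlinarith [mul_le_mul_of_nonneg_left hsq hε, mul_le_mul_of_nonneg_right hε' hR]

theorem scaleKernel_sub_sq_add_le (hε : 0 ≤ ε) (hε' : ε ≤ 1 / 2) (hb : 0 < b) {y c : ℝ}
    (hy : 0 < y) (hc : 0 ≤ c) (hcy : c / y ^ 2 ≤ 1 / 12) (e : ℝ) :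
    scaleKernel ε b ((y - e) ^ 2 + c) ≤
      scaleKernel ε b (y ^ 2) * (1 + ε * (y ^ 2 / (b + y ^ 2)) * (2 * (e / y) +
        (1 + 16 * ε) * (e / y) ^ 2 - c / y ^ 2 + 300 * stepError (e / y) (c / y ^ 2))) +
      {e | y < 12 * |e|}.indicator 1 e := by
  have hs : 0 ≤ c / y ^ 2 := by positivity
  have hg := scaleKernel_pos (ε := ε) hb (sq_nonneg y)
  have hkernel := scaleKernel_sub_sq_add (ε := ε) hb (c := c) (e := e) hy.ne'
  have hρ0 : 0 ≤ y ^ 2 / (b + y ^ 2) := by positivity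
  have hρ1 : y ^ 2 / (b + y ^ 2) ≤ 1 := (div_le_one (by positivity)).2 (by linarith)
  have ht : |e / y| * (12 * y) = 12 * |e| := by
    rw [abs_div, abs_of_pos hy]
    field_simp
  have hR := stepError_nonneg (t := e / y) hs
  set t := e / y
  set s := c / y ^ 2
  set ρ := y ^ 2 / (b + y ^ 2)
  by_cases he : y < 12 * |e|
  · have ht12 : 1 / 12 ≤ |t| := by nlinarith
    have hlarge := mul_le_stepError (t := t) hs (a := 1 / 12) (by norm_num) (by linarith)
    have hbracket : 0 ≤ 2 * t + (1 + 16 * ε) * t ^ 2 - s + 300 * stepError t s := by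
      nlinarith [sq_abs t, neg_abs_le t, mul_nonneg hε (sq_nonneg t)]
    rw [Set.indicator_of_mem (by exact he)]
    exact (scaleKernel_le_one hε hb (by positivity)).trans
      (le_add_of_nonneg_left (mul_nonneg hg.le (by positivity)))
  · have ht12 : |t| ≤ 1 / 12 := by nlinarith
    have hq := (abs_relStep_le hs (by linarith)).trans (by linarith : 3 * (|t| + s) ≤ 1 / 2)
    have hx : 0 < 1 + ρ * (-2 * t + t ^ 2 + s) := by nlinarith [abs_le.1 hq]
    rw [Set.indicator_of_notMem (by exact he), add_zero, hkernel hx]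
    gcongr
    refine (one_add_mul_rpow_neg_le hs (by linarith) hρ0 hρ1 hε hε').trans ?_
    gcongr
    norm_num

variable {ν : Measure ℝ} [IsProbabilityMeasure ν]

theorem IsStandardLaw.eventually_integral_scaleKernel_le (hν : IsStandardLaw ν) {c : ℝ}
    (hc : 1 < c) (hε : 0 ≤ ε) (hε' : ε ≤ 1 / 2) (hεc : 64 * ε ≤ c - 1) :
    ∀ᶠ y in atTop, ∀ b, 0 < b → ∫ e, scaleKernel ε b ((y - e) ^ 2 + c) ∂ν ≤
      scaleKernel ε b (y ^ 2) - ε * (c - 1) / 2 * (scaleKernel ε b (y ^ 2) / (b + y ^ 2)) +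
        ν.real {e | y < 12 * |e|} := by
  have hc0 : 0 ≤ c := by linarith
  have hs : Tendsto (fun y : ℝ => c / y ^ 2) atTop (𝓝 0) :=
    tendsto_const_nhds.div_atTop (tendsto_pow_atTop two_ne_zero)
  filter_upwards [eventually_gt_atTop 0, hs.eventually_le_const (show (0 : ℝ) < 1 / 12 by norm_num),
    (hν.tendsto_sq_mul_integral_stepError hc0).eventually_le_const
      (show 0 < (c - 1) / 1200 by linarith)] with y hy hcy hI b hb
  have hS : MeasurableSet {e | y < 12 * |e|} := measurableSet_lt (by fun_prop) (by fun_prop)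
  have hind : Integrable ({e | y < 12 * |e|}.indicator (1 : ℝ → ℝ)) ν :=
    (integrable_const 1).indicator hS
  have hR := hν.integrable_stepError hc0 y
  set g := scaleKernel ε b (y ^ 2)
  have hg : 0 < g := scaleKernel_pos hb (sq_nonneg y)
  set Q := g * (ε * (y ^ 2 / (b + y ^ 2)))
  have hle := hν.integral_le_of_le_quadratic (f := fun e => scaleKernel ε b ((y - e) ^ 2 + c))
    (r := fun e => 300 * Q * stepError (e / y) (c / y ^ 2) + {e | y < 12 * |e|}.indicator 1 e)
    (a := g - Q * (c / y ^ 2)) (b := Q * (2 / y)) (d := Q * ((1 + 16 * ε) / y ^ 2)) (k := 1)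
    (fun e => (scaleKernel_pos hb (by positivity)).le) ((hR.const_mul _).add hind) fun e => by
      refine (scaleKernel_sub_sq_add_le hε hε' hb hy hc0 hcy e).trans_eq ?_
      ring
  rw [integral_add (hR.const_mul _) hind, integral_const_mul, integral_indicator_one hS] at hle
  set I := ∫ e, stepError (e / y) (c / y ^ 2) ∂ν
  have hgain : g * ε / (b + y ^ 2) * (1 + 16 * ε - c + 300 * (y ^ 2 * I)) ≤
      g * ε / (b + y ^ 2) * (-(c - 1) / 2) := by
    gcongr
    linarith
  have hQ : Q / y ^ 2 = g * ε / (b + y ^ 2) := by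
    simp only [Q]
    field_simp
  have hQI : Q * I = g * ε / (b + y ^ 2) * (y ^ 2 * I) := by
    rw [← hQ]
    field_simp
  linear_combination hle + hgain + 300 * hQI + (1 + 16 * ε - c) * hQ

variable {μ : Measure ℝ} [IsFiniteMeasure μ]

theorem integrable_scaleKernel (hε : 0 ≤ ε) (hμ : ∀ᵐ b ∂μ, 0 < b) (hz : 0 ≤ z) :
    Integrable (fun b => scaleKernel ε b z) μ := by
  refine Integrable.of_bound
    ((measurable_scaleKernel ε).comp measurable_prodMk_left).aestronglyMeasurable 1 ?_
  filter_upwards [hμ] with b hb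
  rw [Real.norm_of_nonneg (scaleKernel_pos hb hz).le]
  exact scaleKernel_le_one hε hb hz

theorem measurable_scaleMixture (ε : ℝ) : Measurable (scaleMixture ε μ) :=
  (measurable_scaleKernel ε).stronglyMeasurable.integral_prod_right'.measurable

theorem scaleMixture_pos (hε : 0 ≤ ε) (hμ : ∀ᵐ b ∂μ, 0 < b) (hμ0 : μ ≠ 0) (hz : 0 ≤ z) :
    0 < scaleMixture ε μ z := by
  have hpos : ∀ᵐ b ∂μ, 0 < scaleKernel ε b z := hμ.mono fun b hb => scaleKernel_pos hb hz
  refine (integral_pos_iff_support_of_nonneg_ae (hpos.mono fun b hb => hb.le)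
    (integrable_scaleKernel hε hμ hz)).2 (pos_iff_ne_zero.2 fun hsupp => hμ0 ?_)
  rw [← ae_eq_bot, ← eventually_false_iff_eq_bot]
  filter_upwards [hpos, measure_eq_zero_iff_ae_notMem.1 hsupp] with b hb hb'
  exact hb' hb.ne'

theorem antitoneOn_scaleMixture (hε : 0 ≤ ε) (hμ : ∀ᵐ b ∂μ, 0 < b) :
    AntitoneOn (scaleMixture ε μ) (Set.Ici 0) := fun _ hz _ hz' hzz =>
  integral_mono_ae (integrable_scaleKernel hε hμ hz') (integrable_scaleKernel hε hμ hz)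
    (hμ.mono fun _ hb => antitoneOn_scaleKernel hε hb hz hz' hzz)

theorem tendsto_scaleMixture (hε : 0 < ε) (hμ : ∀ᵐ b ∂μ, 0 < b) :
    Tendsto (scaleMixture ε μ) atTop (𝓝 0) := by
  rw [← integral_zero ℝ ℝ (μ := μ)]
  refine tendsto_integral_filter_of_dominated_convergence (fun _ => 1)
    (Eventually.of_forall fun z =>
      ((measurable_scaleKernel ε).comp measurable_prodMk_left).aestronglyMeasurable) ?_
    (integrable_const 1) (ae_of_all _ (tendsto_scaleKernel hε))
  filter_upwards [eventually_ge_atTop 0] with z hz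
  filter_upwards [hμ] with b hb
  rw [Real.norm_of_nonneg (scaleKernel_pos hb hz).le]
  exact scaleKernel_le_one hε.le hb hz

theorem integrable_scaleKernel_prod (hε : 0 ≤ ε) (hμ : ∀ᵐ b ∂μ, 0 < b) {g : ℝ → ℝ}
    (hg : Measurable g) (hg0 : ∀ e, 0 ≤ g e) :
    Integrable (fun p : ℝ × ℝ => scaleKernel ε p.2 (g p.1)) (ν.prod μ) := by
  refine Integrable.of_bound ((measurable_scaleKernel ε).comp
    ((hg.comp measurable_fst).prodMk measurable_snd)).aestronglyMeasurable 1 ?_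
  filter_upwards [Measure.quasiMeasurePreserving_snd.ae hμ] with p hp
  rw [Real.norm_of_nonneg (scaleKernel_pos hp (hg0 _)).le]
  exact scaleKernel_le_one hε hp (hg0 _)

theorem inv_le_scaleKernel_div (hε : ε ≤ 1) (hz : 0 ≤ z) (hb : 0 < b) (hzb : z ≤ b) :
    b⁻¹ / 4 ≤ scaleKernel ε b z / (b + z) := by
  have hhalf : 1 / 2 ≤ b / (b + z) := by
    rw [div_le_div_iff₀ two_pos (by positivity)]
    linarith
  have hkernel : 1 / 2 ≤ scaleKernel ε b z := hhalf.trans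
    (Real.self_le_rpow_of_le_one (by positivity) ((div_le_one (by positivity)).2 (by linarith)) hε)
  calc b⁻¹ / 4 = (1 / 2) / (2 * b) := by field_simp; norm_num
    _ ≤ scaleKernel ε b z / (b + z) := by
      gcongr
      linarith

theorem integrable_scaleKernel_div (hε : 0 ≤ ε) (hμ : ∀ᵐ b ∂μ, 0 < b) (hz : 0 < z) :
    Integrable (fun b => scaleKernel ε b z / (b + z)) μ := by
  refine ((integrable_scaleKernel hε hμ hz.le).div_const z).mono'
    (((measurable_scaleKernel ε).comp measurable_prodMk_left).div
      (measurable_id.add_const z)).aestronglyMeasurable ?_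
  filter_upwards [hμ] with b hb
  have hg := scaleKernel_pos (ε := ε) hb hz.le
  rw [Real.norm_of_nonneg (by positivity)]
  gcongr
  linarith

theorem setIntegral_inv_le_integral_scaleKernel_div (hε : 0 ≤ ε) (hε1 : ε ≤ 1)
    (hμ : ∀ᵐ b ∂μ, 0 < b) (hz : 0 < z) :
    (∫ b in Set.Ioi z, b⁻¹ ∂μ) / 4 ≤ ∫ b, scaleKernel ε b z / (b + z) ∂μ := by
  rw [← integral_div]
  calc ∫ b in Set.Ioi z, b⁻¹ / 4 ∂μ ≤ ∫ b in Set.Ioi z, scaleKernel ε b z / (b + z) ∂μ := by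
        refine integral_mono_of_nonneg ?_ (integrable_scaleKernel_div hε hμ hz).integrableOn ?_ <;>
          filter_upwards [ae_restrict_mem measurableSet_Ioi] with b (hb : z < b)
        · have := hz.trans hb
          positivity
        · exact inv_le_scaleKernel_div hε1 hz.le (hz.trans hb) hb.le
    _ ≤ ∫ b, scaleKernel ε b z / (b + z) ∂μ := by
        refine setIntegral_le_integral (integrable_scaleKernel_div hε hμ hz) ?_
        filter_upwards [hμ] with b hb
        exact div_nonneg (scaleKernel_pos hb hz.le).le (by positivity)

theorem integral_scaleMixture_le (hε : 0 ≤ ε) (hμ : ∀ᵐ b ∂μ, 0 < b) (hz : 0 < z) {g : ℝ → ℝ}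
    (hg : Measurable g) (hg0 : ∀ e, 0 ≤ g e) {k a : ℝ}
    (hdrift : ∀ b, 0 < b → ∫ e, scaleKernel ε b (g e) ∂ν ≤
      scaleKernel ε b z - k * (scaleKernel ε b z / (b + z)) + a) :
    ∫ e, scaleMixture ε μ (g e) ∂ν ≤
      scaleMixture ε μ z - k * ∫ b, scaleKernel ε b z / (b + z) ∂μ + μ.real Set.univ * a := by
  have hprod := integrable_scaleKernel_prod (ν := ν) hε hμ hg hg0
  have hkernel := integrable_scaleKernel hε hμ hz.le
  have hloss := (integrable_scaleKernel_div hε hμ hz).const_mul k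
  have hdiff : Integrable (fun b => scaleKernel ε b z - k * (scaleKernel ε b z / (b + z))) μ :=
    hkernel.sub hloss
  calc ∫ e, scaleMixture ε μ (g e) ∂ν = ∫ b, ∫ e, scaleKernel ε b (g e) ∂ν ∂μ :=
        integral_integral_swap hprod
    _ ≤ ∫ b, (scaleKernel ε b z - k * (scaleKernel ε b z / (b + z)) + a) ∂μ :=
        integral_mono_ae hprod.swap.integral_prod_left (hdiff.add (integrable_const a))
          (hμ.mono hdrift)
    _ = scaleMixture ε μ z - k * ∫ b, scaleKernel ε b z / (b + z) ∂μ + μ.real Set.univ * a := by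
        rw [integral_add hdiff (integrable_const a), integral_sub hkernel hloss,
          integral_const_mul, integral_const, smul_eq_mul, scaleMixture]

theorem IsStandardLaw.eventually_integral_scaleMixture_le (hν : IsStandardLaw ν) {c : ℝ}
    (hc : 1 < c) (hε : 0 ≤ ε) (hε' : ε ≤ 1 / 2) (hεc : 64 * ε ≤ c - 1) (hμ : ∀ᵐ b ∂μ, 0 < b)
    (htail : ∀ᶠ z in atTop, μ.real Set.univ * (ν.map fun e => (12 * e) ^ 2).real (Set.Ioi z) ≤
      ε * (c - 1) / 8 * ∫ b in Set.Ioi z, b⁻¹ ∂μ) :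
    ∀ᶠ y in atTop, ∫ e, scaleMixture ε μ ((y - e) ^ 2 + c) ∂ν ≤ scaleMixture ε μ (y ^ 2) := by
  filter_upwards [eventually_gt_atTop 0, hν.eventually_integral_scaleKernel_le hc hε hε' hεc,
    (tendsto_pow_atTop two_ne_zero).eventually htail] with y hy hdrift hmass
  have hset : (fun e : ℝ => (12 * e) ^ 2) ⁻¹' Set.Ioi (y ^ 2) = {e | y < 12 * |e|} := by
    ext e
    simp only [Set.mem_preimage, Set.mem_Ioi, Set.mem_ofPred_eq, sq_lt_sq, abs_of_pos hy, abs_mul,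
      Nat.abs_ofNat]
  rw [map_measureReal_apply (by fun_prop) measurableSet_Ioi, hset] at hmass
  have hmix := integral_scaleMixture_le hε hμ (pow_pos hy 2) (g := fun e => (y - e) ^ 2 + c)
    (by fun_prop) (fun e => by positivity) hdrift
  have hgain := mul_le_mul_of_nonneg_left
    (setIntegral_inv_le_integral_scaleKernel_div hε (by linarith) hμ (pow_pos hy 2))
    (show 0 ≤ ε * (c - 1) / 2 from div_nonneg (mul_nonneg hε (by linarith)) two_pos.le)
  linarith

end ScaleMixture

section TailMeasure

/-- The measure `b dμ(b)` on the half-line `b > R`. Its density compensates the factor `b⁻¹`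
with which the scale `b` contributes to the drift of a scale mixture. -/
noncomputable def tailMeasure (μ : Measure ℝ) (R : ℝ) : Measure ℝ :=
  (μ.restrict (Set.Ioi R)).withDensity fun b => ENNReal.ofReal b

variable {μ : Measure ℝ} {R : ℝ}

theorem isFiniteMeasure_tailMeasure (hint : Integrable (fun b => b) μ) (R : ℝ) :
    IsFiniteMeasure (tailMeasure μ R) :=
  isFiniteMeasure_withDensity_ofReal hint.restrict.hasFiniteIntegral

theorem integral_tailMeasure (hR : 0 ≤ R) (f : ℝ → ℝ) :
    ∫ b, f b ∂tailMeasure μ R = ∫ b in Set.Ioi R, b * f b ∂μ := by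
  rw [tailMeasure, integral_withDensity_eq_integral_toReal_smul ENNReal.measurable_ofReal
    (ae_of_all _ fun b => ENNReal.ofReal_lt_top)]
  refine setIntegral_congr_fun measurableSet_Ioi fun b (hb : R < b) => ?_
  rw [ENNReal.toReal_ofReal (hR.trans hb.le), smul_eq_mul]

theorem tailMeasure_real_univ (hR : 0 ≤ R) :
    (tailMeasure μ R).real Set.univ = ∫ b in Set.Ioi R, b ∂μ := by
  simpa using integral_tailMeasure (μ := μ) hR fun _ => 1

theorem ae_lt_tailMeasure : ∀ᵐ b ∂tailMeasure μ R, R < b :=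
  (withDensity_absolutelyContinuous _ _).ae_le (ae_restrict_mem measurableSet_Ioi)

theorem setIntegral_inv_tailMeasure (hR : 0 ≤ R) {z : ℝ} (hz : R ≤ z) :
    ∫ b in Set.Ioi z, b⁻¹ ∂tailMeasure μ R = μ.real (Set.Ioi z) := by
  rw [← integral_indicator measurableSet_Ioi, integral_tailMeasure hR,
    ← integral_indicator_one measurableSet_Ioi, ← integral_indicator measurableSet_Ioi]
  congr 1 with b
  by_cases hb : z < b
  · rw [Set.indicator_of_mem (Set.mem_Ioi.2 (hz.trans_lt hb)), Set.indicator_of_mem (by exact hb),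
      Set.indicator_of_mem (by exact hb), mul_inv_cancel₀ ((hR.trans hz).trans_lt hb).ne',
      Pi.one_apply]
  · simp [Set.indicator, hb]

theorem integrableOn_inv_Ioi [IsFiniteMeasure μ] {z : ℝ} (hz : 0 < z) :
    IntegrableOn (fun b : ℝ => b⁻¹) (Set.Ioi z) μ := by
  refine Integrable.of_bound measurable_inv.aestronglyMeasurable z⁻¹ ?_
  filter_upwards [ae_restrict_mem measurableSet_Ioi] with b (hb : z < b)
  rw [Real.norm_of_nonneg (inv_nonneg.2 (hz.trans hb).le)]
  exact inv_anti₀ hz hb.le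

theorem exists_measure_tail_le (hint : Integrable (fun b => b) μ) {k : ℝ} (hk : 0 < k) :
    ∃ M : Measure ℝ, IsFiniteMeasure M ∧ M ≠ 0 ∧ (∀ᵐ b ∂M, 0 < b) ∧
      ∀ᶠ z in atTop, M.real Set.univ * μ.real (Set.Ioi z) ≤ k * ∫ b in Set.Ioi z, b⁻¹ ∂M := by
  obtain ⟨R, htail, hR⟩ := (((tendsto_integral_Ioi_zero (μ := μ) (f := fun b => b)
    tendsto_id).eventually_le_const (half_pos hk)).and (eventually_gt_atTop (0 : ℝ))).exists
  have := isFiniteMeasure_tailMeasure hint R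
  -- The point mass only serves to make the measure nonzero when `μ` is carried by `(-∞, R]`.
  let M := tailMeasure μ R + ENNReal.ofReal (k / 2) • Measure.dirac 1
  have hM : IsFiniteMeasure M := by
    have := Measure.smul_finite (Measure.dirac (1 : ℝ)) (ENNReal.ofReal_ne_top (r := k / 2))
    infer_instance
  have hM0 : M ≠ 0 := fun h0 => by
    have hM1 : ENNReal.ofReal (k / 2) ≤ M {1} := by simp [M]
    simp only [h0, Measure.coe_zero, Pi.zero_apply, nonpos_iff_eq_zero,
      ENNReal.ofReal_eq_zero] at hM1
    linarith
  have hpos : ∀ᵐ b ∂M, 0 < b := by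
    refine ae_add_measure_iff.2 ⟨ae_lt_tailMeasure.mono fun b => hR.trans, ?_⟩
    exact Measure.ae_smul_measure ((ae_dirac_iff measurableSet_Ioi).2 one_pos) _
  have hmass : M.real Set.univ ≤ k := by
    have huniv : M.real Set.univ = (tailMeasure μ R).real Set.univ + k / 2 := by
      simp [M, Measure.real, ENNReal.toReal_add, (half_pos hk).le]
    rw [huniv, tailMeasure_real_univ hR.le]
    simp only [id] at htail
    linarith
  refine ⟨M, hM, hM0, hpos, ?_⟩
  filter_upwards [eventually_ge_atTop R] with z hz
  calc M.real Set.univ * μ.real (Set.Ioi z) ≤ k * μ.real (Set.Ioi z) := by gcongr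
    _ = k * ∫ b in Set.Ioi z, b⁻¹ ∂tailMeasure μ R := by
      rw [setIntegral_inv_tailMeasure hR.le hz]
    _ ≤ k * ∫ b in Set.Ioi z, b⁻¹ ∂M := by
      refine mul_le_mul_of_nonneg_left (integral_mono_measure (Measure.restrict_mono le_rfl
        (Measure.le_add_right le_rfl)) ?_ (integrableOn_inv_Ioi (hR.trans_le hz))) hk.le
      exact (ae_restrict_of_ae hpos).mono fun b hb => inv_nonneg.2 hb.le

end TailMeasure

section BesselChain

variable {Ω : Type*} [MeasurableSpace Ω] {P : Measure Ω} [IsProbabilityMeasure P]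
  {κ : ℝ} {ξ : ℕ → Ω → ℝ} {ν : Measure ℝ}

theorem isTransientChain_besselChain (hκ : 0 < κ) (hκ4 : κ < 4) (hξ : IsIIDSeq ξ ν P)
    (hν : IsStandardLaw ν) :
    IsTransientChain P fun x m ω => besselChain κ (fun n => ξ n ω) x m := by
  have := hξ.isProbabilityMeasure
  obtain ⟨u, hu, hpos⟩ := hν.exists_measure_Iio_neg_ne_zero
  have hc : 1 < 4 / κ := (one_lt_div hκ).2 hκ4
  obtain ⟨ε, hε, hε2, hεc⟩ : ∃ ε : ℝ, 0 < ε ∧ ε ≤ 1 / 2 ∧ 64 * ε ≤ 4 / κ - 1 :=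
    ⟨min (1 / 2) ((4 / κ - 1) / 64), lt_min (by norm_num) (by linarith), min_le_left _ _, by
      linarith [min_le_right (1 / 2) ((4 / κ - 1) / 64)]⟩
  have hint : Integrable (fun b => b) (ν.map fun e => (12 * e) ^ 2) := by
    rw [integrable_map_measure (by fun_prop) (by fun_prop)]
    simpa [Function.comp_def, mul_pow] using hν.integrable_sq.const_mul (12 ^ 2)
  obtain ⟨μ, hμ, hμ0, hμpos, htail⟩ := exists_measure_tail_le hint
    (k := ε * (4 / κ - 1) / 8) (by have := sub_pos.2 hc; positivity)
  exact isTransientChain_besselChain_of_drift hκ hξ hu hpos (measurable_scaleMixture ε)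
    (fun z hz => scaleMixture_pos hε.le hμpos hμ0 hz) (antitoneOn_scaleMixture hε.le hμpos)
    (tendsto_scaleMixture hε hμpos)
    (hν.eventually_integral_scaleMixture_le hc hε.le hε2 hεc hμpos htail)

theorem isRecurrentChain_besselChain_of_four_lt (hκ4 : 4 < κ) (hξ : IsIIDSeq ξ ν P)
    (hν : IsStandardLaw ν) :
    IsRecurrentChain P fun x m ω => besselChain κ (fun n => ξ n ω) x m := by
  have := hξ.isProbabilityMeasure
  obtain ⟨u, hu, hpos⟩ := hν.exists_measure_Iio_neg_ne_zero
  have hκ : 0 < κ := by linarith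
  have hc : 0 < 4 / κ := by positivity
  refine isRecurrentChain_besselChain_of_drift (φ := fun z => Real.log z - Real.log (4 / κ))
    (C := -1 - Real.log (4 / κ)) hκ hξ hν.integrable_sq hu hpos (by fun_prop)
    (fun z hz => sub_nonneg.2 (Real.log_le_log hc hz)) (fun z hz => ?_)
    (tendsto_atTop_add_const_right _ _ Real.tendsto_log_atTop)
    (hν.eventually_integral_log_le hc ((div_lt_one hκ).2 hκ4))
  linarith [Real.log_le_sub_one_of_pos (hc.trans_le hz)]

theorem isRecurrentChain_besselChain_four {p : ENNReal} (hp : 2 < p) (hmom : MemLp id p ν)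
    (hξ : IsIIDSeq ξ ν P) (hν : IsStandardLaw ν) :
    IsRecurrentChain P fun x m ω => besselChain 4 (fun n => ξ n ω) x m := by
  have := hξ.isProbabilityMeasure
  obtain ⟨u, hu, hpos⟩ := hν.exists_measure_Iio_neg_ne_zero
  obtain ⟨q, hq2, hq3, hmomq⟩ : ∃ q : ℝ, 2 < q ∧ q ≤ 3 ∧ MemLp id (ENNReal.ofReal q) ν := by
    have hq : min p 3 ≠ ⊤ := ne_top_of_le_ne_top ENNReal.ofNat_ne_top (min_le_right p 3)
    refine ⟨(min p 3).toReal, ?_, ?_, ?_⟩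
    · exact (ENNReal.toReal_lt_toReal ENNReal.ofNat_ne_top hq).2 (lt_min hp (by norm_num))
    · exact ENNReal.toReal_le_of_le_ofReal (by norm_num) (by simp)
    · rw [ENNReal.ofReal_toReal hq]
      exact hmom.mono_exponent (min_le_left p 3)
  refine isRecurrentChain_besselChain_of_drift (φ := fun z => √(Real.log z)) (C := 0) four_pos hξ
    hν.integrable_sq hu hpos (by fun_prop) (fun z _ => Real.sqrt_nonneg _) (fun z hz => ?_)
    (Real.tendsto_sqrt_atTop.comp Real.tendsto_log_atTop) ?_
  · rw [div_self four_ne_zero] at hz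
    rw [Real.sqrt_le_left (by linarith), zero_add]
    nlinarith [Real.log_le_sub_one_of_pos (zero_lt_one.trans_le hz)]
  · simpa only [div_self (four_ne_zero (α := ℝ))] using
      hν.eventually_integral_sqrt_log_le hq2 hq3 hmomq

end BesselChain

section Standardization

variable {Ω : Type*} [MeasurableSpace Ω] {P : Measure Ω}

theorem isIIDSeq_div_const {X : ℕ → Ω → ℝ} (hmeas : ∀ n, Measurable (X n)) (hindep : iIndepFun X P)
    (hident : ∀ n, IdentDistrib (X n) (X 0) P P) (s : ℝ) :
    IsIIDSeq (fun n ω => X n ω / s) (P.map fun ω => X 0 ω / s) P where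
  measurable n := (hmeas n).div_const s
  iIndepFun := hindep.comp (fun _ t => t / s) fun _ => measurable_id.div_const s
  map_eq n := ((hident n).div_const s).map_eq

theorem isStandardLaw_map_div_sqrt {Z : Ω → ℝ} {κ : ℝ} (hκ : 0 < κ) (hL2 : MemLp Z 2 P)
    (hmean : ∫ ω, Z ω ∂P = 0) (hvar : variance Z P = κ) :
    IsStandardLaw (P.map fun ω => Z ω / √κ) := by
  have hmeas : AEMeasurable (fun ω => Z ω / √κ) P :=
    hL2.aestronglyMeasurable.aemeasurable.div_const _
  refine ⟨?_, ?_, ?_⟩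
  · rw [memLp_map_measure_iff (by fun_prop) hmeas]
    simpa only [div_eq_mul_inv, Function.id_comp] using hL2.mul_const (√κ)⁻¹
  · rw [integral_map hmeas (by fun_prop), integral_div, hmean, zero_div]
  · rw [variance_of_integral_eq_zero hL2.aestronglyMeasurable.aemeasurable hmean] at hvar
    rw [integral_map hmeas (by fun_prop)]
    simp only [div_pow, integral_div, Real.sq_sqrt hκ.le, hvar, div_self hκ.ne']

theorem HasPosMgfRadius.memLp {Z : Ω → ℝ} (h : HasPosMgfRadius P Z) (p : NNReal) :
    MemLp Z p P := by
  obtain ⟨ρ, hρ, hexp⟩ := h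
  refine memLp_of_mem_interior_integrableExpSet (mem_interior.2
    ⟨Metric.ball 0 ρ, fun t ht => hexp t ?_, Metric.isOpen_ball, Metric.mem_ball_self hρ⟩) p
  simpa using ht

end Standardization

theorem theorem4_general {Ω : Type*} [MeasurableSpace Ω] (P : Measure Ω) [IsProbabilityMeasure P]
    (κ : ℝ) (hκ : 0 < κ) (X : ℕ → Ω → ℝ) (hmeas : ∀ n, Measurable (X n))
    (hindep : iIndepFun X P) (hident : ∀ n, IdentDistrib (X n) (X 0) P P)
    (hL2 : MemLp (X 0) 2 P) (hmean : ∫ ω, X 0 ω ∂P = 0) (hvar : variance (X 0) P = κ)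
    (X' : ℕ → Ω → ℝ) (hX' : ∀ n ω, X' n ω = X n ω / √κ)
    (Y : ℝ → ℕ → Ω → ℝ) (hY : ∀ x m ω, Y x m ω = besselChain κ (fun n => X' n ω) x m) :
    (κ < 4 → IsTransientChain P Y) ∧
    (4 < κ → IsRecurrentChain P Y) ∧
    (κ = 4 → (∃ p > 2, MemLp (X' 1) p P) → IsRecurrentChain P Y) := by
  obtain rfl : X' = fun n ω => X n ω / √κ := funext₂ hX'
  obtain rfl : Y = fun x m ω => besselChain κ (fun n => X n ω / √κ) x m :=
    funext fun x => funext₂ (hY x)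
  have hξ := isIIDSeq_div_const hmeas hindep hident √κ
  have hν := isStandardLaw_map_div_sqrt hκ hL2 hmean hvar
  refine ⟨fun hκ4 => isTransientChain_besselChain hκ hκ4 hξ hν,
    fun hκ4 => isRecurrentChain_besselChain_of_four_lt hκ4 hξ hν, ?_⟩
  rintro rfl ⟨p, hp, hmom⟩
  refine isRecurrentChain_besselChain_four hp ?_ hξ hν
  rwa [← hξ.map_eq 1, memLp_map_measure_iff (by fun_prop) (hξ.measurable 1).aemeasurable]

theorem theorem4 {Ω : Type*} [MeasurableSpace Ω] (P : MeasureTheory.Measure Ω)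
    [MeasureTheory.IsProbabilityMeasure P] (κ : ℝ) (hκ : 0 < κ)
    (X : ℕ → Ω → ℝ) (hmeas : ∀ n, Measurable (X n))
    (hindep : ProbabilityTheory.iIndepFun X P)
    (hident : ∀ n, ProbabilityTheory.IdentDistrib (X n) (X 0) P P)
    (hL2 : ∀ n, MeasureTheory.MemLp (X n) 2 P)
    (hmean : ∀ n, ∫ ω, X n ω ∂P = 0)
    (hvar : ∀ n, ProbabilityTheory.variance (X n) P = κ)
    (X' : ℕ → Ω → ℝ) (hX' : ∀ n ω, X' n ω = X n ω / Real.sqrt κ)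
    (Y : ℝ → ℕ → Ω → ℝ) (hY : ∀ x m ω, Y x m ω = besselChain κ (fun n => X' n ω) x m) :
    (κ < 4 → IsTransientChain P Y) ∧
    (4 < κ → IsRecurrentChain P Y) ∧
    (κ = 4 → HasPosMgfRadius P (X' 1) → IsRecurrentChain P Y) :=
  (theorem4_general P κ hκ X hmeas hindep hident (hL2 0) (hmean 0) (hvar 0) X' hX' Y hY).imp_right
    (And.imp_right fun h hκ4 hmgf => h hκ4 ⟨(3 : NNReal), by norm_num, hmgf.memLp 3⟩)
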